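/- Let $\mathrm{SL}(2)$ be the group of real $2\times 2$ matrices of determinant one, and let $X_0=\frac12\begin{pmatrix}0&-1\\1&0\end{pmatrix}$, $X_1=\frac12\begin{pmatrix}1&0\\0&-1\end{pmatrix}$, $X_2=\frac12\begin{pmatrix}0&1\\1&0\end{pmatrix}$ be the basis of $\mathfrak{sl}(2)$, extended to left-invariant vector fields. Consider the $\mathbf{k}\oplus\mathbf{z}$ sub-Riemannian structure on $\mathrm{SL}(2)$, that is, the left-invariant one for which $X_1, X_2$ is an orthonormal frame of the distribution. A covector $\lambda\in \mathrm{T}^*_q(\mathrm{SL}(2))$ is written in the coordinates $u=\langle\lambda,X_1(q)\rangle$, $v=\langle\lambda,X_2(q)\rangle$, $w=\langle\lambda,X_0(q)\rangle$; the Hamiltonian is $H=\frac12(u^2+v^2)$, and $\exp_q(\lambda)=\pi(\mathrm{e}^{\overrightarrow{H}}(\lambda))$ is the projection to $\mathrm{SL}(2)$ of the time-one point of the solution of Hamilton's equations (for the canonical symplectic form of $\mathrm{T}^*(\mathrm{SL}(2))$) that starts at $\lambda$. A covector at which $\mathrm{d}\exp_q$ has a non-trivial kernel is called conjugate to $q$.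 For $\lambda_0=(u_0,v_0,w_0)\in\mathrm{T}^*_q(\mathrm{SL}(2))$ put $r=r_{\lambda_0}=w_0^2-(u_0^2+v_0^2)$ and let $$C^0=\Big\{\lambda_0 : H(\lambda_0)\neq 0,\ r>0,\ \sqrt r\cos\frac{\sqrt r}{2}-2\sin\frac{\sqrt r}{2}=0\Big\},\qquad C^1=\Big\{\lambda_0 : H(\lambda_0)\neq 0,\ r>0,\ \sin\frac{\sqrt r}{2}=0\Big\}.$$ **Theorem.** Let $q\in\mathrm{SL}(2)$. All elements of $C^0$ and $C^1$ are conjugate to $q$. In a neighbourhood of every $\lambda_0\in C^0$ the map $\exp_q$ is equivalent to $(x,y,z)\mapsto(x^2,y,z)$, and in a neighbourhood of every $\lambda_0\in C^1$ it is equivalent to $(x,y,z)\mapsto(xz,y,z)$. Here equivalent means that there are a smooth coordinate chart of $\mathrm{T}^*_q(\mathrm{SL}(2))$ centered at $\lambda_0$ and a smooth coordinate chart of $\mathrm{SL}(2)$ centered at $\exp_q(\lambda_0)$ in which $\exp_q$ is represented by the given map. -/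

import Mathlib

open scoped Manifold ContDiff

noncomputable section

namespace SL2Exp

/-- Real `2 × 2` matrices, the ambient space of `SL(2)`. -/
abbrev Mat2 : Type := Matrix (Fin 2) (Fin 2) ℝ

/-- The group `SL(2)` of real `2 × 2` matrices of determinant one, with the subspace topology. -/
abbrev SL2 : Type := Matrix.SpecialLinearGroup (Fin 2) ℝ

/-- The model space `ℝ³`. -/
abbrev R3 : Type := Fin 3 → ℝ

/-! ### The smooth structure of `SL(2)`

The hypersurface `m₁ m₄ - m₂ m₃ = 1` is covered by the two open sets `m₁ ≠ 0` and `m₂ ≠ 0`, on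
each of which it is a graph over three of the four matrix entries. -/

open Classical in
/-- The point of `SL(2)` with first row `(x₀, x₁)` and lower left entry `x₂`, when `x₀ ≠ 0`. -/
def graphA (x : R3) : SL2 :=
  if hx : x 0 ≠ 0 then
    ⟨!![x 0, x 1; x 2, (1 + x 1 * x 2) / x 0], by
      rw [Matrix.det_fin_two_of]; field_simp; ring⟩
  else 1

open Classical in
/-- The point of `SL(2)` with first row `(x₀, x₁)` and lower right entry `x₂`, when `x₁ ≠ 0`. -/
def graphB (x : R3) : SL2 :=
  if hx : x 1 ≠ 0 then
    ⟨!![x 0, x 1; (x 0 * x 2 - 1) / x 1, x 2], by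
      rw [Matrix.det_fin_two_of]; field_simp; ring⟩
  else 1

lemma coe_graphA {x : R3} (hx : x 0 ≠ 0) :
    (graphA x : Mat2) = !![x 0, x 1; x 2, (1 + x 1 * x 2) / x 0] := by
  simp [graphA, hx]

lemma coe_graphB {x : R3} (hx : x 1 ≠ 0) :
    (graphB x : Mat2) = !![x 0, x 1; (x 0 * x 2 - 1) / x 1, x 2] := by
  simp [graphB, hx]

lemma det_entries (M : SL2) : M.1 0 0 * M.1 1 1 - M.1 0 1 * M.1 1 0 = 1 := by
  have h := M.2
  rwa [Matrix.det_fin_two] at h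

lemma continuous_entry (i j : Fin 2) : Continuous fun M : SL2 => M.1 i j :=
  continuous_subtype_val.matrix_elem i j

/-- The chart `M ↦ (m₁, m₂, m₃)` on the open set `m₁ ≠ 0`. -/
def chartA : OpenPartialHomeomorph SL2 R3 where
  toFun M := ![M.1 0 0, M.1 0 1, M.1 1 0]
  invFun := graphA
  source := {M | M.1 0 0 ≠ 0}
  target := {x | x 0 ≠ 0}
  map_source' _ hM := hM
  map_target' x hx := by
    have h : x 0 ≠ 0 := hx
    simp [coe_graphA h, h]
  left_inv' M hM := by
    have h : M.1 0 0 ≠ 0 := hM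
    apply Subtype.ext
    refine (coe_graphA (x := ![M.1 0 0, M.1 0 1, M.1 1 0]) h).trans ?_
    have hd := det_entries M
    ext i j
    fin_cases i <;> fin_cases j <;> simp
    field_simp
    linarith
  right_inv' x hx := by
    have h : x 0 ≠ 0 := hx
    ext i
    fin_cases i <;> simp [coe_graphA h]
  open_source := isOpen_ne_fun (continuous_entry 0 0) continuous_const
  open_target := isOpen_ne_fun (continuous_apply 0) continuous_const
  continuousOn_toFun := by
    apply Continuous.continuousOn
    refine continuous_pi fun i => ?_
    fin_cases i
    · exact continuous_entry 0 0
    · exact continuous_entry 0 1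
    · exact continuous_entry 1 0
  continuousOn_invFun := by
    have hi : Topology.IsInducing (fun M : SL2 => (M.1 : Mat2)) := ⟨rfl⟩
    rw [hi.continuousOn_iff]
    have h : ContinuousOn
        (fun x : R3 => (!![x 0, x 1; x 2, (1 + x 1 * x 2) / x 0] : Mat2)) {x | x 0 ≠ 0} := by
      refine continuousOn_pi.2 fun i => continuousOn_pi.2 fun j => ?_
      fin_cases i <;> fin_cases j <;> simp <;> fun_prop (disch := simp)
    exact h.congr fun x hx => coe_graphA hx

/-- The chart `M ↦ (m₁, m₂, m₄)` on the open set `m₂ ≠ 0`. -/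
def chartB : OpenPartialHomeomorph SL2 R3 where
  toFun M := ![M.1 0 0, M.1 0 1, M.1 1 1]
  invFun := graphB
  source := {M | M.1 0 1 ≠ 0}
  target := {x | x 1 ≠ 0}
  map_source' _ hM := hM
  map_target' x hx := by
    have h : x 1 ≠ 0 := hx
    simp [coe_graphB h, h]
  left_inv' M hM := by
    have h : M.1 0 1 ≠ 0 := hM
    apply Subtype.ext
    refine (coe_graphB (x := ![M.1 0 0, M.1 0 1, M.1 1 1]) h).trans ?_
    have hd := det_entries M
    ext i j
    fin_cases i <;> fin_cases j <;> simp
    field_simp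
    linarith
  right_inv' x hx := by
    have h : x 1 ≠ 0 := hx
    ext i
    fin_cases i <;> simp [coe_graphB h]
  open_source := isOpen_ne_fun (continuous_entry 0 1) continuous_const
  open_target := isOpen_ne_fun (continuous_apply 1) continuous_const
  continuousOn_toFun := by
    apply Continuous.continuousOn
    refine continuous_pi fun i => ?_
    fin_cases i
    · exact continuous_entry 0 0
    · exact continuous_entry 0 1
    · exact continuous_entry 1 1
  continuousOn_invFun := by
    have hi : Topology.IsInducing (fun M : SL2 => (M.1 : Mat2)) := ⟨rfl⟩
    rw [hi.continuousOn_iff]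
    have h : ContinuousOn
        (fun x : R3 => (!![x 0, x 1; (x 0 * x 2 - 1) / x 1, x 2] : Mat2)) {x | x 1 ≠ 0} := by
      refine continuousOn_pi.2 fun i => continuousOn_pi.2 fun j => ?_
      fin_cases i <;> fin_cases j <;> simp <;> fun_prop (disch := simp)
    exact h.congr fun x hx => coe_graphB hx

open Classical in
instance : ChartedSpace R3 SL2 where
  atlas := {chartA, chartB}
  chartAt M := if M.1 0 0 ≠ 0 then chartA else chartB
  mem_chart_source M := by
    by_cases h : M.1 0 0 = 0
    · have hd := det_entries M
      have h1 : M.1 0 1 ≠ 0 := by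
        intro h1
        simp [h, h1] at hd
      simp [h, chartB, h1]
    · simpa [h, chartA] using h
  chart_mem_atlas M := by
    by_cases h : M.1 0 0 = 0 <;> simp [h]

instance : IsManifold 𝓘(ℝ, R3) ∞ SL2 := by
  apply isManifold_of_contDiffOn
  rintro e e' (rfl | rfl) (rfl | rfl)
  · have h : ContDiffOn ℝ ∞ (fun x : R3 => x) {x | x 0 ≠ 0} := contDiffOn_id
    refine (h.congr fun x hx => chartA.right_inv hx).mono ?_
    rintro x hx
    exact hx.1.1
  · have h : ContDiffOn ℝ ∞
        (fun x : R3 => (![x 0, x 1, (1 + x 1 * x 2) / x 0] : R3)) {x | x 0 ≠ 0} := by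
      refine contDiffOn_pi.2 fun i => ?_
      fin_cases i <;> simp <;> fun_prop (disch := simp)
    refine (h.congr fun x hx => ?_).mono fun x hx => hx.1.1
    have hx' : x 0 ≠ 0 := hx
    change ![(graphA x).1 0 0, (graphA x).1 0 1, (graphA x).1 1 1] = _
    simp [coe_graphA hx']
  · have h : ContDiffOn ℝ ∞
        (fun x : R3 => (![x 0, x 1, (x 0 * x 2 - 1) / x 1] : R3)) {x | x 1 ≠ 0} := by
      refine contDiffOn_pi.2 fun i => ?_
      fin_cases i <;> simp <;> fun_prop (disch := simp)
    refine (h.congr fun x hx => ?_).mono fun x hx => hx.1.1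
    have hx' : x 1 ≠ 0 := hx
    change ![(graphB x).1 0 0, (graphB x).1 0 1, (graphB x).1 1 0] = _
    simp [coe_graphB hx']
  · have h : ContDiffOn ℝ ∞ (fun x : R3 => x) {x | x 1 ≠ 0} := contDiffOn_id
    refine (h.congr fun x hx => chartB.right_inv hx).mono ?_
    rintro x hx
    exact hx.1.1

/-! ### The left-invariant frame and the cotangent bundle -/

/-- The basis `X₀, X₁, X₂` of the Lie algebra of traceless matrices. The left-invariant vector
field that it induces is `M ↦ M * X i`. -/
def X : Fin 3 → Mat2 :=
  ![(1 / 2 : ℝ) • !![0, -1; 1, 0], (1 / 2 : ℝ) • !![1, 0; 0, -1], (1 / 2 : ℝ) • !![0, 1; 1, 0]]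

/-- The coefficients of a traceless matrix in the basis `X₀, X₁, X₂`. -/
def coord (A : Mat2) : Fin 3 → ℝ :=
  ![A 1 0 - A 0 1, A 0 0 - A 1 1, A 0 1 + A 1 0]

lemma coord_sum (c : Fin 3 → ℝ) : coord (∑ i, c i • X i) = c := by
  ext i
  fin_cases i <;> simp [coord, X, Fin.sum_univ_three] <;> ring

lemma sum_coord (A : Mat2) (hA : A.trace = 0) : ∑ i, coord A i • X i = A := by
  rw [Matrix.trace_fin_two] at hA
  ext i j
  fin_cases i <;> fin_cases j <;> simp [coord, X, Fin.sum_univ_three] <;> linarith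

/-- A covector at a point `M` of `SL(2)` is given by its values `h i = ⟨h, M * X i⟩` on the frame:
`h 1 = u`, `h 2 = v`, `h 0 = w`. So each fibre of the cotangent bundle is a copy of `ℝ³`. -/
abbrev Covector : Type := Fin 3 → ℝ

/-- The space `Mat2 × ℝ³`, in which `T*SL(2) = SL(2) × ℝ³` is a hypersurface. -/
abbrev Ambient : Type := Mat2 × Covector

/-- The point of `T*SL(2)` with base point `M` and covector `h`. -/
def toAmbient (M : SL2) (h : Covector) : Ambient := (M.1, h)

/-- The vectors of the ambient space that are tangent to `T*SL(2)` at a point `x` of it: the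
first component is tangent to `SL(2)`, that is, `M⁻¹ V` (where `M⁻¹` is the adjugate of `M`) is
traceless. -/
def IsTangent (x ξ : Ambient) : Prop := (x.1.adjugate * ξ.1).trace = 0

/-- The tautological one-form of the cotangent bundle: at the covector `h` over `M` it maps a
tangent vector with first component `V = dπ ξ` to `⟨h, V⟩`. -/
def tautological (x ξ : Ambient) : ℝ := ∑ i, x.2 i * coord (x.1.adjugate * ξ.1) i

/-- The derivative of `f` at `x` in the direction `ξ`. -/
def dirDeriv (f : Ambient → ℝ) (x ξ : Ambient) : ℝ := deriv (fun s : ℝ => f (x + s • ξ)) 0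

/-- The canonical symplectic form: the exterior derivative of the tautological one-form,
`σ(ξ, ζ) = ξ(θ(ζ)) - ζ(θ(ξ))` for constant vector fields `ξ, ζ` of the ambient space. It is used
on pairs of vectors tangent to `T*SL(2)` only. -/
def symplecticForm (x ξ ζ : Ambient) : ℝ :=
  dirDeriv (fun y => tautological y ζ) x ξ - dirDeriv (fun y => tautological y ξ) x ζ

/-- The sub-Riemannian Hamiltonian of the structure with orthonormal frame `X₁, X₂`. -/
def hamiltonian (h : Covector) : ℝ := (1 / 2) * (h 1 ^ 2 + h 2 ^ 2)

/-- `ξ` is the value at `x` of the Hamiltonian vector field: `σ(·, ξ) = dH`. -/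
def IsHamiltonianVector (x ξ : Ambient) : Prop :=
  IsTangent x ξ ∧
    ∀ ζ, IsTangent x ζ → symplecticForm x ζ ξ = dirDeriv (fun y => hamiltonian y.2) x ζ

/-- The curve `t ↦ (M t, h t)` in `T*SL(2)` satisfies Hamilton's equations on `[0, 1]`. -/
def IsNormalExtremal (M : ℝ → SL2) (h : ℝ → Covector) : Prop :=
  ∀ t ∈ Set.Icc (0 : ℝ) 1, ∃ ξ : Ambient,
    (∀ i j, HasDerivWithinAt (fun s => (M s).1 i j) (ξ.1 i j) (Set.Icc 0 1) t) ∧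
    (∀ i, HasDerivWithinAt (fun s => h s i) (ξ.2 i) (Set.Icc 0 1) t) ∧
    IsHamiltonianVector (toAmbient (M t) (h t)) ξ

/-! ### The exponential map -/

/-- The set of covectors at `q` whose normal extremal is defined on `[0, 1]`. -/
def expDomain (q : SL2) : Set Covector :=
  {l | ∃ M h, IsNormalExtremal M h ∧ M 0 = q ∧ h 0 = l}

open Classical in
/-- The sub-Riemannian exponential map at `q`: a covector in its domain is sent to the projection
to `SL(2)` of the time-one point of its normal extremal. The value outside the domain is irrelevant.
-/
def subExp (q : SL2) (l : Covector) : SL2 :=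
  if hl : l ∈ expDomain q then hl.choose 1 else q

/-- The conjugate covectors at `q`: those at which the differential of the exponential map has a
non-trivial kernel. -/
def Conj (q : SL2) : Set Covector :=
  {l | l ∈ expDomain q ∧ ∃ L : R3 →L[ℝ] R3,
    HasMFDerivAt 𝓘(ℝ, R3) 𝓘(ℝ, R3) (subExp q) l L ∧ ∃ v, v ≠ 0 ∧ L v = 0}

/-- `r = w² - (u² + v²)`. -/
def r (l : Covector) : ℝ := l 0 ^ 2 - (l 1 ^ 2 + l 2 ^ 2)

/-- The locus `C⁰`. -/
def C0 : Set Covector :=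
  {l | hamiltonian l ≠ 0 ∧ 0 < r l ∧
    √(r l) * Real.cos (√(r l) / 2) - 2 * Real.sin (√(r l) / 2) = 0}

/-- The locus `C¹`. -/
def C1 : Set Covector :=
  {l | hamiltonian l ≠ 0 ∧ 0 < r l ∧ Real.sin (√(r l) / 2) = 0}

/-- Near the covector `l`, the exponential map at `q` is equivalent to `f`: there are smooth charts
`φ` of the fibre centered at `l` and `ψ` of `SL(2)` centered at the image of `l` in which it is
represented by `f`. -/
def ExpEquivalentNear (q : SL2) (l : Covector) (f : R3 → R3) : Prop :=
  ∃ φ ∈ IsManifold.maximalAtlas 𝓘(ℝ, R3) ∞ Covector,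
  ∃ ψ ∈ IsManifold.maximalAtlas 𝓘(ℝ, R3) ∞ SL2,
    l ∈ φ.source ∧ φ l = 0 ∧ subExp q l ∈ ψ.source ∧ ψ (subExp q l) = 0 ∧
    φ.source ⊆ expDomain q ∧ Set.MapsTo (subExp q) φ.source ψ.source ∧
    ∀ x ∈ φ.source, ψ (subExp q x) = f (φ x)

end SL2Exp

end

namespace SL2Exp

open Set Filter Topology

/-! ### Smooth division -/

/-! In the left trivialization Hamilton's equations read `M' = M (u X₁ + v X₂)`, `w' = 0`, `u' = v
w`, `v' = -u w`. They integrate to `M(t) = q exp(t(u X₁ + v X₂ - w X₀)) exp(t w X₀)`, and for `r >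
0` the first factor is trigonometric with frequency `τ = √r / 2`. Identify a matrix with two complex
numbers `a`, `b`, in which the determinant is `|a|² - |b|²`. The endpoint of the extremal from the
identity is then `a = (cos τ - i (w/2) sin τ / τ) exp(i w/2)`, `b = (sin τ / (2τ)) β` with `β = (u +
i v) exp(-i w/2)`. The two loci are `sin τ = τ cos τ` and `sin τ = 0`.

On `C1` the factor `k = sin τ / τ` vanishes to first order, while `β` does not vanish. Splitting `b
= (k/2) β` into components orthogonal and parallel to the value of `β` at the base covector gives a
product `x z` and a coordinate `z`, where `x` is the ratio of the components of `β`. The angular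
displacement of `a` provides `y`.

On `C0` one has `sin τ ≠ 0` and `w ≠ 0`, so `(τ, b)` are local coordinates on the fibre and `w` is a
function of them. For fixed `b` the point `a` runs on the circle `|a|² = 1 + |b|²`, with angular
velocity equal to a nonzero factor times `sin τ - τ cos τ`. The turning value `τ₀` is thus the same
for all `b` and is nondegenerate, since `sin τ - τ cos τ` has derivative `τ sin τ`. Hadamard's lemma
with parameter `b` turns the displacement of `a` from its turning point into a square, which is the
fold.

Conjugacy is read off from the normal forms by `ExpEquivalentNear.mem_conj`. The main steps are
`subExp_eq` (explicit solution and uniqueness), `expEquivalentNear_of_eq` (charts from the inverse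
function theorem), `hasDerivAt_endRe` and `hasDerivAt_endIm` (motion on the circle), and
`exists_endpoint_area_eq_sq_mul` (the square). -/

/-- Differentiation under the integral sign, by induction on the order. The spaces are quantified
after `n` because the derivative takes values in `E →L[ℝ] F`, to which the induction hypothesis has
to apply. -/
lemma contDiff_intervalIntegral_nat (n : ℕ) :
    ∀ {E F : Type} [NormedAddCommGroup E] [NormedSpace ℝ E] [FiniteDimensional ℝ E]
      [NormedAddCommGroup F] [NormedSpace ℝ F] [CompleteSpace F] {G : E × ℝ → F},
      ContDiff ℝ n G → ContDiff ℝ n fun p => ∫ s in (0 : ℝ)..1, G (p, s) := by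
  induction n with
  | zero =>
    intro E F _ _ _ _ _ _ G hG
    have hG' : Continuous G := hG.continuous
    simp only [Nat.cast_zero, contDiff_zero]
    exact intervalIntegral.continuous_parametric_intervalIntegral_of_continuous' (by fun_prop) 0 1
  | succ n ih =>
    intro E F _ _ _ _ _ _ G hG
    have hGc : Continuous G := hG.continuous
    have hd : ContDiff ℝ n (fderiv ℝ G) := hG.fderiv_right (by norm_cast)
    have hD : ContDiff ℝ n
        (fun q : E × ℝ => (fderiv ℝ G q).comp (ContinuousLinearMap.inl ℝ E ℝ)) :=
      hd.clm_comp contDiff_const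
    have hDc := hD.continuous
    rw [Nat.cast_succ, contDiff_succ_iff_hasFDerivAt]
    refine ⟨_, ih hD, fun p => ?_⟩
    -- Finite dimension makes this set compact, and so yields a constant dominating bound near `p`.
    have hK : IsCompact (Metric.closedBall p 1 ×ˢ Icc (0 : ℝ) 1) :=
      (isCompact_closedBall p 1).prod isCompact_Icc
    obtain ⟨C, hC⟩ := hK.exists_bound_of_continuousOn hDc.continuousOn
    refine intervalIntegral.hasFDerivAt_integral_of_dominated_of_fderiv_le
      (F := fun p s => G (p, s)) (bound := fun _ => C)
      (F' := fun p s => (fderiv ℝ G (p, s)).comp (ContinuousLinearMap.inl ℝ E ℝ))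
      (Metric.closedBall_mem_nhds p one_pos) ?_ ?_ ?_ ?_ ?_ ?_
    · exact Eventually.of_forall fun x =>
        (hGc.comp (Continuous.prodMk_right x)).aestronglyMeasurable
    · exact (hGc.comp (Continuous.prodMk_right p)).intervalIntegrable 0 1
    · exact (hDc.comp (Continuous.prodMk_right p)).aestronglyMeasurable
    · refine Eventually.of_forall fun s hs x hx => hC (x, s) ⟨hx, ?_⟩
      rw [uIoc_of_le zero_le_one] at hs
      exact ⟨hs.1.le, hs.2⟩
    · exact intervalIntegrable_const
    · refine Eventually.of_forall fun s _ x _ => ?_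
      have h1 : HasFDerivAt G (fderiv ℝ G (x, s)) (x, s) :=
        (hG.differentiable (by simp) _).hasFDerivAt
      exact h1.comp x (hasFDerivAt_prodMk_left x s)

lemma contDiff_intervalIntegral {E F : Type} [NormedAddCommGroup E] [NormedSpace ℝ E]
    [FiniteDimensional ℝ E] [NormedAddCommGroup F] [NormedSpace ℝ F] [CompleteSpace F]
    {G : E × ℝ → F} (hG : ContDiff ℝ ∞ G) :
    ContDiff ℝ ∞ fun p => ∫ s in (0 : ℝ)..1, G (p, s) :=
  contDiff_infty.2 fun n => contDiff_intervalIntegral_nat n (hG.of_le (by exact_mod_cast le_top))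

/-- Hadamard's lemma: a smooth function that vanishes for `t = 0` is `t` times a smooth one. -/
lemma exists_contDiff_eq_mul {E : Type} [NormedAddCommGroup E] [NormedSpace ℝ E]
    [FiniteDimensional ℝ E] {f : E × ℝ → ℝ} (hf : ContDiff ℝ ∞ f) (h0 : ∀ p, f (p, 0) = 0) :
    ∃ h : E × ℝ → ℝ, ContDiff ℝ ∞ h ∧ ∀ p t, f (p, t) = t * h (p, t) := by
  have hd : ContDiff ℝ ∞ (fderiv ℝ f) := hf.fderiv_right le_rfl
  have hG : ContDiff ℝ ∞
      (fun q : (E × ℝ) × ℝ => fderiv ℝ f (q.1.1, q.2 * q.1.2) ((0 : E), (1 : ℝ))) := by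
    refine ContDiff.clm_apply (hd.comp ?_) contDiff_const
    fun_prop
  refine ⟨_, contDiff_intervalIntegral hG, fun p t => ?_⟩
  -- The quotient is the mean of `∂f/∂t` over the segment from `(p, 0)` to `(p, t)`.
  have hder : ∀ s ∈ uIcc (0 : ℝ) 1, HasDerivAt (fun s : ℝ => f (p, s * t))
      (t * fderiv ℝ f (p, s * t) ((0 : E), (1 : ℝ))) s := by
    intro s _
    have h1 : HasFDerivAt f (fderiv ℝ f (p, s * t)) (p, s * t) :=
      (hf.differentiable (by simp) _).hasFDerivAt
    have h2 : HasDerivAt (fun s : ℝ => (p, s * t)) ((0 : E), 1 * t) s :=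
      (hasDerivAt_const s p).prodMk ((hasDerivAt_id s).mul_const t)
    refine (h1.comp_hasDerivAt s h2).congr_deriv ?_
    rw [show ((0 : E), 1 * t) = t • ((0 : E), (1 : ℝ)) by simp, map_smul, smul_eq_mul]
  have hc : Continuous fun s : ℝ => t * fderiv ℝ f (p, s * t) ((0 : E), (1 : ℝ)) :=
    continuous_const.mul (hG.continuous.comp (by fun_prop : Continuous fun s : ℝ => ((p, t), s)))
  have key := intervalIntegral.integral_eq_sub_of_hasDerivAt hder (hc.intervalIntegrable 0 1)
  simp only [one_mul, zero_mul, h0, sub_zero] at key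
  rw [← key, intervalIntegral.integral_const_mul]

/-- A smooth function with a double zero at `t = 0` is `t ^ 2` times a smooth one. -/
lemma exists_contDiff_eq_sq_mul {E : Type} [NormedAddCommGroup E] [NormedSpace ℝ E]
    [FiniteDimensional ℝ E] {f : E × ℝ → ℝ} (hf : ContDiff ℝ ∞ f) (h0 : ∀ p, f (p, 0) = 0)
    (h1 : ∀ p, HasDerivAt (fun t => f (p, t)) 0 0) :
    ∃ h : E × ℝ → ℝ, ContDiff ℝ ∞ h ∧ ∀ p t, f (p, t) = t ^ 2 * h (p, t) := by
  obtain ⟨g, hg, hfg⟩ := exists_contDiff_eq_mul hf h0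
  have hg0 : ∀ p, g (p, 0) = 0 := by
    intro p
    have hgd : DifferentiableAt ℝ (fun t : ℝ => g (p, t)) 0 :=
      (hg.comp (contDiff_prodMk_right p)).differentiable (by simp) 0
    have h2 := (hasDerivAt_id (0 : ℝ)).mul hgd.hasDerivAt
    have h3 : HasDerivAt (fun t => f (p, t)) _ 0 :=
      h2.congr_of_eventuallyEq (Eventually.of_forall fun t => by simp [hfg])
    simpa using h3.unique (h1 p)
  obtain ⟨h, hh, hgh⟩ := exists_contDiff_eq_mul hg hg0
  exact ⟨h, hh, fun p t => by rw [hfg, hgh]; ring⟩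

/-- If `t ^ 2 * h t` has derivative `D t` and `D` has derivative `c` at `0`, then `2 h 0 = c`. -/
lemma two_mul_eq_of_hasDerivAt_sq_mul {h D : ℝ → ℝ} {c : ℝ} (hh : ContDiff ℝ ∞ h)
    (hD : ∀ t, HasDerivAt (fun t => t ^ 2 * h t) (D t) t) (hc : HasDerivAt D c 0) :
    2 * h 0 = c := by
  have hd : Differentiable ℝ h := hh.differentiable (by simp)
  have hd' : Differentiable ℝ (deriv h) :=
    (contDiff_infty_iff_deriv.1 hh).2.differentiable (by simp)
  have hDeq : D = fun t => 2 * t * h t + t ^ 2 * deriv h t := by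
    funext t
    have := ((hasDerivAt_id t).pow 2).mul (hd t).hasDerivAt
    refine (hD t).unique (this.congr_deriv ?_)
    simp
  have h2 := (((hasDerivAt_id (0 : ℝ)).const_mul 2).mul (hd 0).hasDerivAt).add
    (((hasDerivAt_id (0 : ℝ)).pow 2).mul (hd' 0).hasDerivAt)
  rw [hDeq] at hc
  have := hc.unique h2
  simp at this
  exact this.symm

/-! ### Charts from the inverse function theorem -/

/-- Injectivity of the differential is phrased through derivatives along lines, so that applications
need only one-variable calculus. -/
lemma exists_localDiffeomorph {E : Type*} [NormedAddCommGroup E] [NormedSpace ℝ E]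
    [FiniteDimensional ℝ E] {g : E → E} {U : Set E} {a : E} (hU : IsOpen U) (ha : a ∈ U)
    (hg : ContDiffOn ℝ ∞ g U)
    (hinj : ∀ v, HasDerivAt (fun t : ℝ => g (a + t • v)) 0 0 → v = 0) :
    ∃ d : OpenPartialHomeomorph E E, a ∈ d.source ∧ d.source ⊆ U ∧ (∀ x, d x = g x) ∧
      ContDiffOn ℝ ∞ d d.source ∧ ContDiffOn ℝ ∞ d.symm d.target := by
  have : CompleteSpace E := FiniteDimensional.complete ℝ E
  have hga : ∀ x ∈ U, ContDiffAt ℝ ∞ g x := fun x hx => hg.contDiffAt (hU.mem_nhds hx)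
  have hfd : ∀ x ∈ U, HasFDerivAt g (fderiv ℝ g x) x := fun x hx =>
    ((hga x hx).differentiableAt (by simp)).hasFDerivAt
  have hker : LinearMap.ker (fderiv ℝ g a : E →ₗ[ℝ] E) = ⊥ := by
    rw [LinearMap.ker_eq_bot']
    intro v hv
    apply hinj
    have hl : HasDerivAt (fun t : ℝ => a + t • v) v 0 := by
      simpa using ((hasDerivAt_id (0 : ℝ)).smul_const v).const_add a
    have h1 : HasFDerivAt g (fderiv ℝ g a) (a + (0 : ℝ) • v) := by simpa using hfd a ha
    exact (h1.comp_hasDerivAt 0 hl).congr_deriv hv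
  let e : E ≃L[ℝ] E := (LinearEquiv.ofInjectiveEndo _ (LinearMap.ker_eq_bot.1 hker)
    ).toContinuousLinearEquiv
  have he : (e : E →L[ℝ] E) = fderiv ℝ g a := by
    ext v; rfl
  have hfda : HasFDerivAt g (e : E →L[ℝ] E) a := he ▸ hfd a ha
  let d₀ := (hga a ha).toOpenPartialHomeomorph g hfda (by simp)
  -- Restricting to the open set where the differential is invertible makes the inverse smooth on
  -- the whole target, not only at the image of `a`.
  let V : Set E := U ∩ fderiv ℝ g ⁻¹' range ((↑) : (E ≃L[ℝ] E) → E →L[ℝ] E)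
  have hV : IsOpen V :=
    (hg.continuousOn_fderiv_of_isOpen hU (by simp)).isOpen_inter_preimage hU
      ContinuousLinearEquiv.isOpen
  have hsrc : (d₀.restrOpen V hV).source = d₀.source ∩ V := d₀.restrOpen_source V hV
  refine ⟨d₀.restrOpen V hV, ?_, ?_, fun x => rfl, ?_, ?_⟩
  · rw [hsrc]
    exact ⟨(hga a ha).mem_toOpenPartialHomeomorph_source hfda (by simp), ha, e, he⟩
  · rw [hsrc]
    exact fun x hx => hx.2.1
  · intro x hx
    rw [hsrc] at hx
    exact (hga x hx.2.1).contDiffWithinAt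
  · intro y hy
    have hx := (d₀.restrOpen V hV).map_target hy
    rw [hsrc] at hx
    obtain ⟨-, hxU, e', he'⟩ := hx
    exact ((d₀.restrOpen V hV).contDiffAt_symm hy (f₀' := e') (he' ▸ hfd _ hxU)
      (hga _ hxU)).contDiffWithinAt

/-- A smooth map to the model space with injective derivative at `p`, as expressed in the preferred
chart at `p`, restricts to a chart. -/
lemma exists_chart {N : Type*} [TopologicalSpace N] [ChartedSpace R3 N] [IsManifold 𝓘(ℝ, R3) ∞ N]
    (p : N) {G : N → R3} {U : Set N} (hU : IsOpen U) (hp : p ∈ U)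
    (hG : ContMDiffOn 𝓘(ℝ, R3) 𝓘(ℝ, R3) ∞ G U)
    (hinj : ∀ v : R3,
      HasDerivAt (fun t : ℝ => G ((chartAt R3 p).symm (chartAt R3 p p + t • v))) 0 0 → v = 0) :
    ∃ ψ ∈ IsManifold.maximalAtlas 𝓘(ℝ, R3) ∞ N, p ∈ ψ.source ∧ ψ.source ⊆ U ∧
      ∀ x ∈ ψ.source, ψ x = G x := by
  set e := chartAt R3 p with he
  have heA : e ∈ IsManifold.maximalAtlas 𝓘(ℝ, R3) ∞ N := IsManifold.chart_mem_maximalAtlas p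
  have hpe : p ∈ e.source := mem_chart_source R3 p
  have hes := contMDiffOn_symm_of_mem_maximalAtlas heA
  have heo := contMDiffOn_of_mem_maximalAtlas heA
  have hW : IsOpen (e.target ∩ e.symm ⁻¹' U) := e.isOpen_inter_preimage_symm hU
  have hg : ContDiffOn ℝ ∞ (G ∘ e.symm) (e.target ∩ e.symm ⁻¹' U) := by
    rw [← contMDiffOn_iff_contDiffOn]
    exact hG.comp (hes.mono inter_subset_left) fun x hx => hx.2
  obtain ⟨d, hd1, hd2, hd3, hd4, hd5⟩ := exists_localDiffeomorph hW (a := e p)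
    ⟨e.map_source hpe, by simpa [e.left_inv hpe] using hp⟩ hg hinj
  refine ⟨e.trans d, ?_, ?_, ?_, ?_⟩
  · apply OpenPartialHomeomorph.mem_maximalAtlas_of_contMDiffOn
    · rw [OpenPartialHomeomorph.trans_source, OpenPartialHomeomorph.coe_trans]
      exact (contMDiffOn_iff_contDiffOn.2 hd4).comp (heo.mono inter_subset_left) fun x hx => hx.2
    · rw [OpenPartialHomeomorph.trans_target, OpenPartialHomeomorph.coe_trans_symm]
      exact hes.comp ((contMDiffOn_iff_contDiffOn.2 hd5).mono inter_subset_left) fun x hx => hx.2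
  · rw [OpenPartialHomeomorph.trans_source]
    exact ⟨hpe, hd1⟩
  · rw [OpenPartialHomeomorph.trans_source]
    rintro x ⟨hx, hx'⟩
    have := (hd2 hx').2
    rwa [mem_preimage, e.left_inv hx] at this
  · rw [OpenPartialHomeomorph.trans_source]
    rintro x ⟨hx, hx'⟩
    rw [OpenPartialHomeomorph.coe_trans, Function.comp_apply, hd3, Function.comp_apply,
      e.left_inv hx]

/-! ### Charts of `SL(2)` -/

/-- In either chart three entries are coordinates and the fourth is a rational function of them with
nonvanishing denominator. -/
lemma contMDiff_entry (i j : Fin 2) :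
    ContMDiff 𝓘(ℝ, R3) 𝓘(ℝ, ℝ) ∞ fun M : SL2 => M.1 i j := by
  intro M
  rw [contMDiffAt_iff_source, ModelWithCorners.range_eq_univ, contMDiffWithinAt_univ,
    contMDiffAt_iff_contDiffAt]
  by_cases h : M.1 0 0 = 0
  · have h1 : M.1 0 1 ≠ 0 := by
      intro h1
      have hd := det_entries M
      simp [h, h1] at hd
    have hc : chartAt R3 M = chartB := by simp [chartAt, ChartedSpace.chartAt, h]
    have hev : ∀ᶠ x : R3 in 𝓝 (chartB M), x 1 ≠ 0 :=
      (continuous_apply (1 : Fin 3)).continuousAt.eventually_ne h1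
    have hx1 : chartB M 1 ≠ 0 := h1
    simp only [extChartAt, hc, OpenPartialHomeomorph.extend, mfld_simps]
    have hs : ContDiffAt ℝ ∞ (fun x : R3 =>
        (!![x 0, x 1; (x 0 * x 2 - 1) / x 1, x 2] : Mat2) i j) (chartB M) := by
      fin_cases i <;> fin_cases j <;> simp <;> fun_prop (disch := assumption)
    refine hs.congr_of_eventuallyEq (hev.mono fun x hx => ?_)
    change (graphB x).1 i j = _
    rw [coe_graphB hx]
  · have hc : chartAt R3 M = chartA := by simp [chartAt, ChartedSpace.chartAt, h]
    have hev : ∀ᶠ x : R3 in 𝓝 (chartA M), x 0 ≠ 0 :=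
      (continuous_apply (0 : Fin 3)).continuousAt.eventually_ne h
    have hx1 : chartA M 0 ≠ 0 := h
    simp only [extChartAt, hc, OpenPartialHomeomorph.extend, mfld_simps]
    have hs : ContDiffAt ℝ ∞ (fun x : R3 =>
        (!![x 0, x 1; x 2, (1 + x 1 * x 2) / x 0] : Mat2) i j) (chartA M) := by
      fin_cases i <;> fin_cases j <;> simp <;> fun_prop (disch := assumption)
    refine hs.congr_of_eventuallyEq (hev.mono fun x hx => ?_)
    change (graphA x).1 i j = _
    rw [coe_graphA hx]

/-- The coordinates of a chart of `SL(2)` are matrix entries. -/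
lemma exists_chartAt_apply_eq (M : SL2) (k : Fin 3) :
    ∃ i j, ∀ N : SL2, chartAt R3 M N k = N.1 i j := by
  by_cases h : M.1 0 0 = 0
  · have hc : chartAt R3 M = chartB := by simp [chartAt, ChartedSpace.chartAt, h]
    rw [hc]
    fin_cases k
    · exact ⟨0, 0, fun _ => rfl⟩
    · exact ⟨0, 1, fun _ => rfl⟩
    · exact ⟨1, 1, fun _ => rfl⟩
  · have hc : chartAt R3 M = chartA := by simp [chartAt, ChartedSpace.chartAt, h]
    rw [hc]
    fin_cases k
    · exact ⟨0, 0, fun _ => rfl⟩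
    · exact ⟨0, 1, fun _ => rfl⟩
    · exact ⟨1, 0, fun _ => rfl⟩

/-- A smooth map `SL(2) → ℝ³` restricts to a chart at `p` if it does not annihilate the velocity of
a regular curve through `p`. -/
lemma exists_chart_of_curves (p : SL2) {G : SL2 → R3} {U : Set SL2} (hU : IsOpen U) (hp : p ∈ U)
    (hG : ContMDiffOn 𝓘(ℝ, R3) 𝓘(ℝ, R3) ∞ G U)
    (hinj : ∀ (c : ℝ → SL2) (W : Mat2), c 0 = p →
      (∀ i j, HasDerivAt (fun t => (c t).1 i j) (W i j) 0) →
      HasDerivAt (fun t => G (c t)) 0 0 → W = 0) :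
    ∃ ψ ∈ IsManifold.maximalAtlas 𝓘(ℝ, R3) ∞ SL2, p ∈ ψ.source ∧ ψ.source ⊆ U ∧
      ∀ x ∈ ψ.source, ψ x = G x := by
  refine exists_chart p hU hp hG fun v hv => ?_
  set e := chartAt R3 p with he
  have hpe : p ∈ e.source := mem_chart_source R3 p
  have hpt : e p ∈ e.target := e.map_source hpe
  have hl : HasDerivAt (fun t : ℝ => e p + t • v) v 0 := by
    simpa using ((hasDerivAt_id (0 : ℝ)).smul_const v).const_add (e p)
  have hcd : ∀ i j, DifferentiableAt ℝ (fun t : ℝ => (e.symm (e p + t • v)).1 i j) 0 := by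
    intro i j
    have h1 : ContMDiffOn 𝓘(ℝ, R3) 𝓘(ℝ, ℝ) ∞ (fun x => (e.symm x).1 i j) e.target :=
      (contMDiff_entry i j).comp_contMDiffOn
        (contMDiffOn_symm_of_mem_maximalAtlas (IsManifold.chart_mem_maximalAtlas p))
    rw [contMDiffOn_iff_contDiffOn] at h1
    have h2 : DifferentiableAt ℝ (fun x => (e.symm x).1 i j) (e p + (0 : ℝ) • v) := by
      rw [zero_smul, add_zero]
      exact (h1.contDiffAt (e.open_target.mem_nhds hpt)).differentiableAt (by simp)
    exact h2.comp (0 : ℝ) hl.differentiableAt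
  have hW := hinj (fun t => e.symm (e p + t • v))
    (Matrix.of fun i j => deriv (fun t : ℝ => (e.symm (e p + t • v)).1 i j) 0)
    (by simp [e.left_inv hpe]) (fun i j => (hcd i j).hasDerivAt) hv
  have hev : ∀ᶠ t : ℝ in 𝓝 0, e p + t • v ∈ e.target := by
    refine hl.continuousAt.eventually (e.open_target.mem_nhds ?_)
    simpa using hpt
  ext k
  obtain ⟨i, j, hij⟩ := exists_chartAt_apply_eq p k
  have h1 : HasDerivAt (fun t : ℝ => (e p + t • v) k) (v k) 0 := (hasDerivAt_pi.1 hl) k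
  have h2 : HasDerivAt (fun t : ℝ => (e.symm (e p + t • v)).1 i j) 0 0 := by
    refine (hcd i j).hasDerivAt.congr_deriv ?_
    exact congrFun (congrFun hW i) j
  refine h1.unique (h2.congr_of_eventuallyEq (hev.mono fun t ht => ?_))
  change (e p + t • v) k = (e.symm (e p + t • v)).1 i j
  rw [← hij, ← he, e.right_inv ht]

/-! ### Hamilton's equations -/

/-- The adjugate of a `2 × 2` matrix is linear in the matrix, so the one-form is bilinear in the
base and covector components of its base point; the derivative is the linear term of a quadratic
polynomial. -/
lemma dirDeriv_tautological (x ξ ζ : Ambient) :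
    dirDeriv (fun y => tautological y ζ) x ξ =
      tautological (x.1, ξ.2) ζ + tautological (ξ.1, x.2) ζ := by
  have key : ∀ s : ℝ, tautological (x + s • ξ) ζ =
      tautological x ζ + s * (tautological (x.1, ξ.2) ζ + tautological (ξ.1, x.2) ζ) +
        s ^ 2 * tautological ξ ζ := by
    intro s
    simp [tautological, coord, Fin.sum_univ_three, Matrix.adjugate_fin_two, Matrix.mul_apply]
    ring
  unfold dirDeriv
  simp only [key]
  have h := (((hasDerivAt_id (0 : ℝ)).mul_const
    (tautological (x.1, ξ.2) ζ + tautological (ξ.1, x.2) ζ)).const_add (tautological x ζ)).add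
    (((hasDerivAt_id (0 : ℝ)).pow 2).mul_const (tautological ξ ζ))
  refine Eq.trans ?_ (h.deriv.trans ?_)
  · rfl
  · simp

lemma dirDeriv_hamiltonian (x ξ : Ambient) :
    dirDeriv (fun y => hamiltonian y.2) x ξ = x.2 1 * ξ.2 1 + x.2 2 * ξ.2 2 := by
  have key : ∀ s : ℝ, hamiltonian (x + s • ξ).2 =
      hamiltonian x.2 + s * (x.2 1 * ξ.2 1 + x.2 2 * ξ.2 2) + s ^ 2 * hamiltonian ξ.2 := by
    intro s
    simp [hamiltonian]
    ring
  unfold dirDeriv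
  simp only [key]
  have h := (((hasDerivAt_id (0 : ℝ)).mul_const
    (x.2 1 * ξ.2 1 + x.2 2 * ξ.2 2)).const_add (hamiltonian x.2)).add
    (((hasDerivAt_id (0 : ℝ)).pow 2).mul_const (hamiltonian ξ.2))
  refine Eq.trans ?_ (h.deriv.trans ?_)
  · rfl
  · simp

/-- The velocity `u X₁ + v X₂`. -/
noncomputable def velocity (h : Covector) : Mat2 := !![h 1 / 2, h 2 / 2; h 2 / 2, -(h 1 / 2)]

lemma adjugate_mul_self_mul (M : SL2) (A : Mat2) : M.1.adjugate * (M.1 * A) = A := by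
  rw [← Matrix.mul_assoc, Matrix.adjugate_mul, M.2, one_smul, Matrix.one_mul]

/-- The symplectic form in the left trivialization. -/
lemma symplecticForm_mul (M : SL2) (h a b : Covector) (A B : Mat2) :
    symplecticForm (toAmbient M h) (M.1 * A, a) (M.1 * B, b) =
      ∑ i, (a i * coord B i - b i * coord A i) +
        ∑ i, h i * coord (A.adjugate * B - B.adjugate * A) i := by
  have h1 : ∀ A B : Mat2, (M.1 * A).adjugate * (M.1 * B) = A.adjugate * B := by
    intro A B
    rw [Matrix.adjugate_mul_distrib, Matrix.mul_assoc, adjugate_mul_self_mul]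
  rw [symplecticForm, dirDeriv_tautological, dirDeriv_tautological]
  simp only [toAmbient, tautological, adjugate_mul_self_mul, h1, Fin.sum_univ_three]
  simp [coord]
  ring

lemma isHamiltonianVector_iff (M : SL2) (h : Covector) (ξ : Ambient) :
    IsHamiltonianVector (toAmbient M h) ξ ↔
      ξ = (M.1 * velocity h, ![0, h 2 * h 0, -(h 1 * h 0)]) := by
  have hM : ∀ V : Mat2, M.1 * (M.1.adjugate * V) = V := by
    intro V
    rw [← Matrix.mul_assoc, Matrix.mul_adjugate, M.2, one_smul, Matrix.one_mul]
  have hT : ∀ (A : Mat2) (a : Covector),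
      IsTangent (toAmbient M h) (M.1 * A, a) ↔ A.trace = 0 := by
    intro A a
    simp only [IsTangent, toAmbient, adjugate_mul_self_mul]
  obtain ⟨V, b⟩ := ξ
  obtain ⟨B, rfl⟩ : ∃ B, V = M.1 * B := ⟨_, (hM V).symm⟩
  constructor
  · rintro ⟨ht, hσ⟩
    rw [hT, Matrix.trace_fin_two] at ht
    have hσ' : ∀ (A : Mat2) (a : Covector), A.trace = 0 →
        ∑ i, (a i * coord B i - b i * coord A i) +
          ∑ i, h i * coord (A.adjugate * B - B.adjugate * A) i = h 1 * a 1 + h 2 * a 2 := by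
      intro A a hA
      rw [← symplecticForm_mul, hσ _ ((hT A a).2 hA), dirDeriv_hamiltonian]
      rfl
    -- Vertical test vectors determine the base velocity; the three frame directions then determine
    -- the covector velocity.
    have e0 := hσ' 0 (Pi.single 0 1) (by simp)
    have e1 := hσ' 0 (Pi.single 1 1) (by simp)
    have e2 := hσ' 0 (Pi.single 2 1) (by simp)
    have f0 := hσ' !![0, -1; 1, 0] 0 (by simp [Matrix.trace_fin_two])
    have f1 := hσ' !![1, 0; 0, -1] 0 (by simp [Matrix.trace_fin_two])
    have f2 := hσ' !![0, 1; 1, 0] 0 (by simp [Matrix.trace_fin_two])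
    simp [coord, Fin.sum_univ_three, Matrix.adjugate_fin_two, Matrix.vecMul,
      dotProduct, Fin.sum_univ_two] at e0 e1 e2 f0 f1 f2
    have b00 : B 0 0 = h 1 / 2 := by linarith
    have b11 : B 1 1 = -(h 1 / 2) := by linarith
    have b01 : B 0 1 = h 2 / 2 := by linarith
    have b10 : B 1 0 = h 2 / 2 := by linarith
    have hB : B = velocity h := by
      ext i j
      fin_cases i <;> fin_cases j <;> simp [velocity, *]
    rw [b00, b01, b10, b11] at f0 f1 f2
    have hb : b = ![0, h 2 * h 0, -(h 1 * h 0)] := by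
      ext i
      fin_cases i <;> simp <;> linarith
    rw [hB, hb]
  · rintro hξ
    rw [hξ]
    refine ⟨(hT _ _).2 (by simp [velocity, Matrix.trace_fin_two]), ?_⟩
    rintro ⟨V, a⟩ hζ
    obtain ⟨A, rfl⟩ : ∃ A, V = M.1 * A := ⟨_, (hM V).symm⟩
    rw [hT, Matrix.trace_fin_two] at hζ
    rw [symplecticForm_mul, dirDeriv_hamiltonian]
    have hA : A 1 1 = - A 0 0 := by linarith
    simp [coord, Fin.sum_univ_three, Matrix.adjugate_fin_two, Matrix.vecMul,
      dotProduct, Fin.sum_univ_two, velocity, toAmbient, hA]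
    ring

/-! ### Explicit normal extremals -/

/-- The half frequency `τ = √r / 2`. -/
noncomputable def tau (l : Covector) : ℝ := √(r l) / 2

lemma tau_pos {l : Covector} (hl : 0 < r l) : 0 < tau l :=
  half_pos (Real.sqrt_pos.2 hl)

lemma four_mul_tau_sq {l : Covector} (hl : 0 < r l) :
    4 * tau l ^ 2 = l 0 ^ 2 - (l 1 ^ 2 + l 2 ^ 2) := by
  have h := Real.sq_sqrt hl.le
  rw [tau, div_pow, h, r]
  ring

/-- The covector part of the normal extremal through `l`. -/
noncomputable def momentum (l : Covector) (t : ℝ) : Covector :=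
  ![l 0, l 1 * Real.cos (l 0 * t) + l 2 * Real.sin (l 0 * t),
    l 2 * Real.cos (l 0 * t) - l 1 * Real.sin (l 0 * t)]

/-- `exp (t (u X₁ + v X₂ - w X₀)) exp (t w X₀)`, for `l = (w, u, v)` with `r l > 0`. -/
noncomputable def flowMatrix (l : Covector) (t : ℝ) : Mat2 :=
  !![Real.cos (tau l * t) + Real.sin (tau l * t) / tau l * (l 1 / 2),
      Real.sin (tau l * t) / tau l * ((l 2 + l 0) / 2);
    Real.sin (tau l * t) / tau l * ((l 2 - l 0) / 2),
      Real.cos (tau l * t) - Real.sin (tau l * t) / tau l * (l 1 / 2)] *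
  !![Real.cos (l 0 / 2 * t), -Real.sin (l 0 / 2 * t);
    Real.sin (l 0 / 2 * t), Real.cos (l 0 / 2 * t)]

lemma det_flowMatrix {l : Covector} (hl : 0 < r l) (t : ℝ) : (flowMatrix l t).det = 1 := by
  have hτ := (tau_pos hl).ne'
  have h4 := four_mul_tau_sq hl
  have h1 := Real.sin_sq_add_cos_sq (tau l * t)
  have h2 := Real.sin_sq_add_cos_sq (l 0 / 2 * t)
  rw [flowMatrix, Matrix.det_mul, Matrix.det_fin_two_of, Matrix.det_fin_two_of]
  have h3 : Real.cos (l 0 / 2 * t) * Real.cos (l 0 / 2 * t) -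
      -Real.sin (l 0 / 2 * t) * Real.sin (l 0 / 2 * t) = 1 := by linarith
  rw [h3, mul_one]
  field_simp
  linear_combination 4 * tau l ^ 2 * h1 - Real.sin (tau l * t) ^ 2 * h4

lemma flowMatrix_zero (l : Covector) : flowMatrix l 0 = 1 := by
  rw [flowMatrix]
  ext i j
  fin_cases i <;> fin_cases j <;> simp [Matrix.mul_apply]

lemma momentum_zero (l : Covector) : momentum l 0 = l := by
  ext i
  fin_cases i <;> simp [momentum]

/-- With `A = u X₁ + v X₂ - w X₀`, the derivative of `exp(tA) exp(t w X₀)` is `exp(tA) (u X₁ + v X₂)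
exp(t w X₀)`, and conjugating `u X₁ + v X₂` by the rotation turns `(u, v)` into `momentum l t`. In
the entrywise check, `h4` carries the relation `A² = -τ²`. -/
lemma hasDerivAt_flowMatrix {l : Covector} (hl : 0 < r l) (t : ℝ) (i j : Fin 2) :
    HasDerivAt (fun t => flowMatrix l t i j)
      ((flowMatrix l t * velocity (momentum l t)) i j) t := by
  have hτ := (tau_pos hl).ne'
  have h4 := four_mul_tau_sq hl
  have h2 := Real.sin_sq_add_cos_sq (l 0 / 2 * t)
  have ec : Real.cos (l 0 * t) =
      Real.cos (l 0 / 2 * t) ^ 2 - Real.sin (l 0 / 2 * t) ^ 2 := by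
    rw [← Real.cos_two_mul']; ring_nf
  have es : Real.sin (l 0 * t) =
      2 * Real.sin (l 0 / 2 * t) * Real.cos (l 0 / 2 * t) := by
    rw [← Real.sin_two_mul]; ring_nf
  have hlin : ∀ a : ℝ, HasDerivAt (fun t : ℝ => a * t) a t := fun a => by
    simpa using (hasDerivAt_id t).const_mul a
  have dC := (hlin (l 0 / 2)).cos
  have dS := (hlin (l 0 / 2)).sin
  have dc := (hlin (tau l)).cos
  have ds := (hlin (tau l)).sin.div_const (tau l)
  have d00 := dc.add (ds.mul_const (l 1 / 2))
  have d01 := ds.mul_const ((l 2 + l 0) / 2)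
  have d10 := ds.mul_const ((l 2 - l 0) / 2)
  have d11 := dc.sub (ds.mul_const (l 1 / 2))
  obtain ⟨k, hk⟩ : ∃ k, Real.sin (tau l * t) = k * tau l :=
    ⟨Real.sin (tau l * t) / tau l, by field_simp⟩
  fin_cases i <;> fin_cases j
  · refine (((d00.mul dC).add (d01.mul dS)).congr_of_eventuallyEq (Eventually.of_forall
      fun t => ?_)).congr_deriv ?_
    · simp [flowMatrix, Matrix.mul_apply]
    · simp [flowMatrix, Matrix.mul_apply, velocity, momentum, ec, es, hk, hτ]
      set C := Real.cos (l 0 / 2 * t)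
      set S := Real.sin (l 0 / 2 * t)
      set c := Real.cos (tau l * t)
      linear_combination -(k * C / 4) * h4 -
        (((c + k * (l 1 / 2)) * l 1 + k * ((l 2 + l 0) / 2) * l 2) / 2 * C +
          ((c + k * (l 1 / 2)) * l 2 - k * ((l 2 + l 0) / 2) * l 1) / 2 * S) * h2
  · refine (((d00.mul dS.neg).add (d01.mul dC)).congr_of_eventuallyEq (Eventually.of_forall
      fun t => ?_)).congr_deriv ?_
    · simp [flowMatrix, Matrix.mul_apply]
    · simp [flowMatrix, Matrix.mul_apply, velocity, momentum, ec, es, hk, hτ]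
      set C := Real.cos (l 0 / 2 * t)
      set S := Real.sin (l 0 / 2 * t)
      set c := Real.cos (tau l * t)
      linear_combination (k * S / 4) * h4 -
        (-((c + k * (l 1 / 2)) * l 1 + k * ((l 2 + l 0) / 2) * l 2) / 2 * S +
          ((c + k * (l 1 / 2)) * l 2 - k * ((l 2 + l 0) / 2) * l 1) / 2 * C) * h2
  · refine (((d10.mul dC).add (d11.mul dS)).congr_of_eventuallyEq (Eventually.of_forall
      fun t => ?_)).congr_deriv ?_
    · simp [flowMatrix, Matrix.mul_apply]
    · simp [flowMatrix, Matrix.mul_apply, velocity, momentum, ec, es, hk, hτ]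
      set C := Real.cos (l 0 / 2 * t)
      set S := Real.sin (l 0 / 2 * t)
      set c := Real.cos (tau l * t)
      linear_combination -(k * S / 4) * h4 -
        ((k * ((l 2 - l 0) / 2) * l 1 + (c - k * (l 1 / 2)) * l 2) / 2 * C +
          (k * ((l 2 - l 0) / 2) * l 2 - (c - k * (l 1 / 2)) * l 1) / 2 * S) * h2
  · refine (((d10.mul dS.neg).add (d11.mul dC)).congr_of_eventuallyEq (Eventually.of_forall
      fun t => ?_)).congr_deriv ?_
    · simp [flowMatrix, Matrix.mul_apply]
    · simp [flowMatrix, Matrix.mul_apply, velocity, momentum, ec, es, hk, hτ]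
      set C := Real.cos (l 0 / 2 * t)
      set S := Real.sin (l 0 / 2 * t)
      set c := Real.cos (tau l * t)
      linear_combination -(k * C / 4) * h4 -
        (-(k * ((l 2 - l 0) / 2) * l 1 + (c - k * (l 1 / 2)) * l 2) / 2 * S +
          (k * ((l 2 - l 0) / 2) * l 2 - (c - k * (l 1 / 2)) * l 1) / 2 * C) * h2

lemma hasDerivAt_momentum (l : Covector) (t : ℝ) (i : Fin 3) :
    HasDerivAt (fun t => momentum l t i)
      ((![0, momentum l t 2 * momentum l t 0, -(momentum l t 1 * momentum l t 0)] : Covector) i)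
      t := by
  have hlin : HasDerivAt (fun t : ℝ => l 0 * t) (l 0) t := by
    simpa using (hasDerivAt_id t).const_mul (l 0)
  have dC := hlin.cos
  have dS := hlin.sin
  fin_cases i
  · exact hasDerivAt_const t (l 0)
  · refine ((dC.const_mul (l 1)).add (dS.const_mul (l 2))).congr_deriv ?_
    simp [momentum]
    ring
  · refine ((dC.const_mul (l 2)).sub (dS.const_mul (l 1))).congr_deriv ?_
    simp [momentum]
    ring

lemma mul_apply_two (A B : Mat2) (i j : Fin 2) :
    (A * B) i j = A i 0 * B 0 j + A i 1 * B 1 j := by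
  rw [Matrix.mul_apply, Fin.sum_univ_two]

/-- The base curve of the normal extremal through `l` at the identity. -/
noncomputable def flow {l : Covector} (hl : 0 < r l) (t : ℝ) : SL2 :=
  ⟨flowMatrix l t, det_flowMatrix hl t⟩

lemma isNormalExtremal_flow (q : SL2) {l : Covector} (hl : 0 < r l) :
    IsNormalExtremal (fun t => q * flow hl t) (momentum l) := by
  intro t _
  refine ⟨_, fun i j => ?_, fun i => (hasDerivAt_momentum l t i).hasDerivWithinAt,
    (isHamiltonianVector_iff _ _ _).2 rfl⟩
  have h := ((hasDerivAt_flowMatrix hl t 0 j).const_mul (q.1 i 0)).add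
    ((hasDerivAt_flowMatrix hl t 1 j).const_mul (q.1 i 1))
  refine ((h.congr_of_eventuallyEq (Eventually.of_forall fun t => ?_)).congr_deriv
    ?_).hasDerivWithinAt
  · exact mul_apply_two q.1 (flowMatrix l t) i j
  · refine (mul_apply_two q.1 (flowMatrix l t * velocity (momentum l t)) i j).symm.trans ?_
    rw [← Matrix.mul_assoc]
    rfl

/-! ### Uniqueness of normal extremals -/

lemma eq_of_hasDerivWithinAt_zero {f : ℝ → ℝ}
    (hf : ∀ t ∈ Icc (0 : ℝ) 1, HasDerivWithinAt f 0 (Icc 0 1) t) :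
    ∀ t ∈ Icc (0 : ℝ) 1, f t = f 0 :=
  constant_of_derivWithin_zero (fun t ht => (hf t ht).differentiableWithinAt) fun t ht =>
    (hf t ⟨ht.1, ht.2.le⟩).derivWithin (uniqueDiffOn_Icc zero_lt_one t ⟨ht.1, ht.2.le⟩)

/-- Once `w` is known to be constant, `(u, v)` rotates uniformly; rotating it back by the angle `w
t` gives two constants of motion. -/
lemma IsNormalExtremal.momentum_eq {M : ℝ → SL2} {h : ℝ → Covector} (hMh : IsNormalExtremal M h) :
    ∀ t ∈ Icc (0 : ℝ) 1, h t = momentum (h 0) t := by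
  have hd : ∀ t ∈ Icc (0 : ℝ) 1, ∀ i, HasDerivWithinAt (fun s => h s i)
      ((![0, h t 2 * h t 0, -(h t 1 * h t 0)] : Covector) i) (Icc 0 1) t := by
    intro t ht i
    obtain ⟨ξ, -, h2, h3⟩ := hMh t ht
    rw [isHamiltonianVector_iff] at h3
    have := h2 i
    rwa [h3] at this
  have h0 : ∀ t ∈ Icc (0 : ℝ) 1, h t 0 = h 0 0 :=
    eq_of_hasDerivWithinAt_zero fun t ht => by simpa using hd t ht 0
  have hlin : ∀ t, HasDerivWithinAt (fun t : ℝ => h 0 0 * t) (h 0 0) (Icc 0 1) t := fun t => by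
    simpa using ((hasDerivAt_id t).const_mul (h 0 0)).hasDerivWithinAt
  have ha := eq_of_hasDerivWithinAt_zero
    (f := fun t => h t 1 * Real.cos (h 0 0 * t) - h t 2 * Real.sin (h 0 0 * t)) fun t ht => by
      refine (((hd t ht 1).mul (hlin t).cos).sub ((hd t ht 2).mul (hlin t).sin)).congr_deriv ?_
      simp [h0 t ht]
      ring
  have hb := eq_of_hasDerivWithinAt_zero
    (f := fun t => h t 1 * Real.sin (h 0 0 * t) + h t 2 * Real.cos (h 0 0 * t)) fun t ht => by
      refine (((hd t ht 1).mul (hlin t).sin).add ((hd t ht 2).mul (hlin t).cos)).congr_deriv ?_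
      simp [h0 t ht]
      ring
  intro t ht
  have ea := ha t ht
  have eb := hb t ht
  have h2 := Real.sin_sq_add_cos_sq (h 0 0 * t)
  simp only [mul_zero, Real.cos_zero, Real.sin_zero, mul_one, sub_zero, zero_add] at ea eb
  ext i
  fin_cases i
  · exact h0 t ht
  · simp only [momentum, Fin.mk_one, Matrix.cons_val_one, Matrix.cons_val_zero]
    rw [← ea, ← eb]
    linear_combination -h t 1 * h2
  · simp only [momentum, Fin.reduceFinMk, Matrix.cons_val]
    rw [← ea, ← eb]
    linear_combination -h t 2 * h2

/-- Two solutions of the same left-invariant equation differ by a constant left factor: the entries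
of `M(t)` times the adjugate of `flowMatrix` have derivative zero (`ha` and `hb` are the two
columns). -/
lemma IsNormalExtremal.base_eq {M : ℝ → SL2} {h : ℝ → Covector} (hMh : IsNormalExtremal M h)
    (hl : 0 < r (h 0)) : ∀ t ∈ Icc (0 : ℝ) 1, M t = M 0 * flow hl t := by
  have hm := hMh.momentum_eq
  have hd : ∀ t ∈ Icc (0 : ℝ) 1, ∀ i j, HasDerivWithinAt (fun s => (M s).1 i j)
      (((M t).1 * velocity (momentum (h 0) t)) i j) (Icc 0 1) t := by
    intro t ht i j
    obtain ⟨ξ, h1, -, h3⟩ := hMh t ht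
    rw [isHamiltonianVector_iff] at h3
    have := h1 i j
    rwa [h3, hm t ht] at this
  have hE : ∀ t i j, HasDerivWithinAt (fun s => flowMatrix (h 0) s i j)
      ((flowMatrix (h 0) t * velocity (momentum (h 0) t)) i j) (Icc 0 1) t :=
    fun t i j => (hasDerivAt_flowMatrix hl t i j).hasDerivWithinAt
  have ha : ∀ i, ∀ t ∈ Icc (0 : ℝ) 1, _ := fun i => eq_of_hasDerivWithinAt_zero
    (f := fun t => (M t).1 i 0 * flowMatrix (h 0) t 1 1 - (M t).1 i 1 * flowMatrix (h 0) t 1 0)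
    fun t ht => by
      refine (((hd t ht i 0).mul (hE t 1 1)).sub ((hd t ht i 1).mul (hE t 1 0))).congr_deriv ?_
      simp [Matrix.mul_apply, velocity]
      ring
  have hb : ∀ i, ∀ t ∈ Icc (0 : ℝ) 1, _ := fun i => eq_of_hasDerivWithinAt_zero
    (f := fun t => (M t).1 i 1 * flowMatrix (h 0) t 0 0 - (M t).1 i 0 * flowMatrix (h 0) t 0 1)
    fun t ht => by
      refine (((hd t ht i 1).mul (hE t 0 0)).sub ((hd t ht i 0).mul (hE t 0 1))).congr_deriv ?_
      simp [Matrix.mul_apply, velocity]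
      ring
  intro t ht
  have hdet := det_flowMatrix hl t
  rw [Matrix.det_fin_two] at hdet
  apply Subtype.ext
  ext i j
  have ea := ha i t ht
  have eb := hb i t ht
  simp only [flowMatrix_zero, Matrix.one_apply_eq, mul_one, ne_eq, one_ne_zero, zero_ne_one,
    not_false_eq_true, Matrix.one_apply_ne, mul_zero, sub_zero] at ea eb
  rw [Matrix.SpecialLinearGroup.coe_mul, Matrix.mul_apply, Fin.sum_univ_two, ← ea, ← eb]
  fin_cases j
  · change (M t).1 i 0 = _ * flowMatrix (h 0) t 0 0 + _ * flowMatrix (h 0) t 1 0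
    linear_combination -(M t).1 i 0 * hdet
  · change (M t).1 i 1 = _ * flowMatrix (h 0) t 0 1 + _ * flowMatrix (h 0) t 1 1
    linear_combination -(M t).1 i 1 * hdet

lemma flow_zero {l : Covector} (hl : 0 < r l) : flow hl 0 = 1 :=
  Subtype.ext (flowMatrix_zero l)

lemma mem_expDomain (q : SL2) {l : Covector} (hl : 0 < r l) : l ∈ expDomain q :=
  ⟨_, _, isNormalExtremal_flow q hl, by simp [flow_zero], momentum_zero l⟩

/-- The extremal chosen in the definition of `subExp` is irrelevant by uniqueness. -/
lemma subExp_eq (q : SL2) {l : Covector} (hl : 0 < r l) : subExp q l = q * flow hl 1 := by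
  have hd := mem_expDomain q hl
  rw [subExp, dif_pos hd]
  obtain ⟨h, h1, h2, h3⟩ := hd.choose_spec
  subst h3
  rw [h1.base_eq hl 1 ⟨zero_le_one, le_rfl⟩, h2]

/-! ### Coordinates on `SL(2)` and criteria for normal forms -/

/-- The linear coordinates of `2 × 2` matrices in which the determinant is
`x₀ ^ 2 + x₁ ^ 2 - x₂ ^ 2 - x₃ ^ 2`. -/
noncomputable def lorentz (N : Mat2) : Fin 4 → ℝ :=
  ![(N 0 0 + N 1 1) / 2, (N 1 0 - N 0 1) / 2, (N 0 0 - N 1 1) / 2, (N 0 1 + N 1 0) / 2]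

lemma lorentz_sq (N : SL2) :
    lorentz N.1 0 ^ 2 + lorentz N.1 1 ^ 2 - lorentz N.1 2 ^ 2 - lorentz N.1 3 ^ 2 = 1 := by
  have h := det_entries N
  simp only [lorentz, Matrix.cons_val]
  linear_combination h

lemma contMDiff_lorentz (q : SL2) :
    ContMDiff 𝓘(ℝ, R3) 𝓘(ℝ, Fin 4 → ℝ) ∞ fun M : SL2 => lorentz (q.1 * M.1) := by
  have hL : ContDiff ℝ ∞ fun m : Fin 2 → Fin 2 → ℝ => lorentz (q.1 * Matrix.of m) := by
    refine contDiff_pi.2 fun k => ?_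
    fin_cases k <;> simp [lorentz, mul_apply_two] <;> fun_prop
  have hM : ContMDiff 𝓘(ℝ, R3) 𝓘(ℝ, Fin 2 → Fin 2 → ℝ) ∞
      fun M : SL2 => (fun i j => M.1 i j : Fin 2 → Fin 2 → ℝ) :=
    contMDiff_pi_space.2 fun i => contMDiff_pi_space.2 fun j => contMDiff_entry i j
  exact hL.contMDiff.comp hM

lemma lorentz_injective {N : Mat2} (h : lorentz N = 0) : N = 0 := by
  have h0 := congrFun h 0
  have h1 := congrFun h 1
  have h2 := congrFun h 2
  have h3 := congrFun h 3
  simp [lorentz] at h0 h1 h2 h3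
  ext i j
  fin_cases i <;> fin_cases j <;> simp <;> linarith

/-- A smooth function of the linear coordinates of `q⁻¹ M` restricts to a chart of `SL(2)` if its
differential is injective on the tangent space of the quadric. -/
lemma exists_chart_of_lorentz (q p : SL2) {g : (Fin 4 → ℝ) → R3} (hg : ContDiff ℝ ∞ g)
    (hinj : ∀ (y : ℝ → Fin 4 → ℝ) (a : Fin 4 → ℝ), y 0 = lorentz (q⁻¹ * p).1 →
      HasDerivAt y a 0 → HasDerivAt (fun t => g (y t)) 0 0 →
      y 0 0 * a 0 + y 0 1 * a 1 - y 0 2 * a 2 - y 0 3 * a 3 = 0 → a = 0) :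
    ∃ ψ ∈ IsManifold.maximalAtlas 𝓘(ℝ, R3) ∞ SL2, p ∈ ψ.source ∧
      ∀ M ∈ ψ.source, ψ M = g (lorentz (q⁻¹ * M).1) := by
  have hc : ContMDiff 𝓘(ℝ, R3) 𝓘(ℝ, R3) ∞ fun M : SL2 => g (lorentz (q⁻¹ * M).1) :=
    hg.contMDiff.comp (contMDiff_lorentz q⁻¹)
  obtain ⟨ψ, h1, h2, -, h3⟩ := exists_chart_of_curves p isOpen_univ (mem_univ p)
    hc.contMDiffOn fun c W hc0 hW hd => by
      have hN : ∀ i j, HasDerivAt (fun t => (q⁻¹ * c t).1 i j) ((q⁻¹.1 * W) i j) 0 := by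
        intro i j
        refine ((((hW 0 j).const_mul (q⁻¹.1 i 0)).add ((hW 1 j).const_mul
          (q⁻¹.1 i 1))).congr_of_eventuallyEq (Eventually.of_forall fun t => ?_)).congr_deriv ?_
        · exact mul_apply_two q⁻¹.1 (c t).1 i j
        · exact (mul_apply_two q⁻¹.1 W i j).symm
      have hy : HasDerivAt (fun t => lorentz (q⁻¹ * c t).1) (lorentz (q⁻¹.1 * W)) 0 := by
        refine hasDerivAt_pi.2 fun k => ?_
        fin_cases k
        · exact ((hN 0 0).add (hN 1 1)).div_const 2
        · exact ((hN 1 0).sub (hN 0 1)).div_const 2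
        · exact ((hN 0 0).sub (hN 1 1)).div_const 2
        · exact ((hN 0 1).add (hN 1 0)).div_const 2
      have hyk := hasDerivAt_pi.1 hy
      -- Differentiating the equation of the quadric along the curve gives the tangency condition in
      -- `hinj`.
      have hq : HasDerivAt (fun t => lorentz (q⁻¹ * c t).1 0 ^ 2 + lorentz (q⁻¹ * c t).1 1 ^ 2 -
          lorentz (q⁻¹ * c t).1 2 ^ 2 - lorentz (q⁻¹ * c t).1 3 ^ 2) _ 0 :=
        ((((hyk 0).pow 2).add ((hyk 1).pow 2)).sub ((hyk 2).pow 2)).sub ((hyk 3).pow 2)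
      have hq0 : HasDerivAt (fun t => lorentz (q⁻¹ * c t).1 0 ^ 2 + lorentz (q⁻¹ * c t).1 1 ^ 2 -
          lorentz (q⁻¹ * c t).1 2 ^ 2 - lorentz (q⁻¹ * c t).1 3 ^ 2) 0 0 :=
        (hasDerivAt_const (0 : ℝ) (1 : ℝ)).congr_of_eventuallyEq
          (Eventually.of_forall fun t => lorentz_sq _)
      have hqe := hq.unique hq0
      have hz := hinj _ _ (by simp [hc0]) hy hd (by
        simp only [Nat.cast_ofNat, Nat.add_one_sub_one, pow_one] at hqe
        linarith)
      have hW0 := lorentz_injective hz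
      calc W = q.1 * (q⁻¹.1 * W) := by
            rw [← Matrix.mul_assoc, ← Matrix.SpecialLinearGroup.coe_mul, mul_inv_cancel,
              Matrix.SpecialLinearGroup.coe_one, Matrix.one_mul]
        _ = 0 := by rw [hW0, Matrix.mul_zero]
  exact ⟨ψ, h1, h2, h3⟩

/-! ### Regularity on `r > 0` and passage from normal forms to conjugacy -/

lemma contDiff_r : ContDiff ℝ ∞ r := by
  unfold r
  fun_prop

lemma isOpen_r_pos : IsOpen {l : Covector | 0 < r l} :=
  isOpen_lt continuous_const contDiff_r.continuous

lemma contDiffAt_tau {l : Covector} (hl : 0 < r l) : ContDiffAt ℝ ∞ tau l :=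
  (contDiff_r.contDiffAt.sqrt hl.ne').div_const 2

lemma continuousOn_subExp (q : SL2) : ContinuousOn (subExp q) {l | 0 < r l} := by
  have hi : Topology.IsInducing (fun M : SL2 => (M.1 : Mat2)) := ⟨rfl⟩
  rw [hi.continuousOn_iff]
  have hf : ContinuousOn (fun l => flowMatrix l 1) {l | 0 < r l} := by
    intro l hl
    have ht : ContDiffAt ℝ ∞ tau l := contDiffAt_tau hl
    have hτ : tau l ≠ 0 := (tau_pos hl).ne'
    refine ContinuousAt.continuousWithinAt (continuousAt_pi.2 fun i => continuousAt_pi.2 fun j => ?_)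
    refine ContDiffAt.continuousAt (𝕜 := ℝ) (n := ∞) ?_
    fin_cases i <;> fin_cases j <;> simp [flowMatrix, mul_apply_two] <;>
      fun_prop (disch := assumption)
  have hq : Continuous fun N : Mat2 => q.1 * N := continuous_const.matrix_mul continuous_id
  refine (hq.comp_continuousOn hf).congr fun l hl => ?_
  change (subExp q l).1 = q.1 * flowMatrix l 1
  rw [subExp_eq q hl]
  rfl

/-- A criterion for a normal form of the exponential map, in terms of the explicit solution. -/
lemma expEquivalentNear_of_eq (q : SL2) {l : Covector} (hl : 0 < r l) {f Φ : R3 → R3}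
    {g : (Fin 4 → ℝ) → R3} {U : Set R3} (hU : IsOpen U) (hlU : l ∈ U) (hΦ : ContDiffOn ℝ ∞ Φ U)
    (hΦ0 : Φ l = 0) (hΦinj : ∀ v, HasDerivAt (fun t : ℝ => Φ (l + t • v)) 0 0 → v = 0)
    (hg : ContDiff ℝ ∞ g) (hg0 : g (lorentz (flowMatrix l 1)) = 0)
    (hginj : ∀ (y : ℝ → Fin 4 → ℝ) (a : Fin 4 → ℝ), y 0 = lorentz (flowMatrix l 1) →
      HasDerivAt y a 0 → HasDerivAt (fun t => g (y t)) 0 0 →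
      y 0 0 * a 0 + y 0 1 * a 1 - y 0 2 * a 2 - y 0 3 * a 3 = 0 → a = 0)
    (heq : ∀ x ∈ U, 0 < r x → g (lorentz (flowMatrix x 1)) = f (Φ x)) :
    ExpEquivalentNear q l f := by
  have hexp : ∀ x, 0 < r x → (q⁻¹ * subExp q x).1 = flowMatrix x 1 := by
    intro x hx
    rw [subExp_eq q hx, inv_mul_cancel_left]
    rfl
  obtain ⟨φ, hφ, hlφ, hφU, hφe⟩ := exists_chart (N := R3) l hU hlU
    (contMDiffOn_iff_contDiffOn.2 hΦ) hΦinj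
  obtain ⟨ψ, hψ, hlψ, hψe⟩ := exists_chart_of_lorentz q (subExp q l) hg (by
    rw [hexp l hl]; exact hginj)
  -- The source chart is shrunk to this set, on which the explicit formula holds and the image lies
  -- in the target chart.
  have hs : IsOpen ({x : R3 | 0 < r x} ∩ subExp q ⁻¹' ψ.source) :=
    (continuousOn_subExp q).isOpen_inter_preimage isOpen_r_pos ψ.open_source
  have hsrc := φ.restr_source' _ hs
  refine ⟨φ.restr _, restr_mem_maximalAtlas (contDiffGroupoid ∞ 𝓘(ℝ, R3)) hφ hs, ψ, hψ,
    ?_, ?_, hlψ, ?_, ?_, ?_, ?_⟩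
  · rw [hsrc]
    exact ⟨hlφ, hl, hlψ⟩
  · rw [OpenPartialHomeomorph.restr_apply, hφe l hlφ, hΦ0]
  · rw [hψe _ hlψ, hexp l hl, hg0]
  · rw [hsrc]
    exact fun x hx => mem_expDomain q hx.2.1
  · rw [hsrc]
    exact fun x hx => hx.2.2
  · rw [hsrc]
    intro x hx
    rw [OpenPartialHomeomorph.restr_apply, hφe x hx.1, hψe _ hx.2.2, hexp x hx.2.1,
      heq x (hφU hx.1) hx.2.1]

/-- If the exponential map is equivalent to a map that is singular at the origin, then the covector
is conjugate. -/
lemma ExpEquivalentNear.mem_conj {q : SL2} {l : Covector} {f : R3 → R3}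
    (h : ExpEquivalentNear q l f) (hfd : DifferentiableAt ℝ f 0) {v : R3}
    (hv : v ≠ 0) (hfv' : HasDerivAt (fun t : ℝ => f (t • v)) 0 0) : l ∈ Conj q := by
  obtain ⟨f', hf⟩ := hfd
  have hfv : f' v = 0 := by
    have h1 : HasDerivAt (fun t : ℝ => t • v) v 0 := by
      simpa using (hasDerivAt_id (0 : ℝ)).smul_const v
    exact (hf.comp_hasDerivAt_of_eq (0 : ℝ) h1 (by simp)).unique hfv'
  obtain ⟨φ, hφ, ψ, hψ, hl, hφl, hE, hψE, hdom, hmaps, heq⟩ := h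
  have h0 : (0 : R3) ∈ φ.target := hφl ▸ φ.map_source hl
  have h0' : (0 : R3) ∈ ψ.target := hψE ▸ ψ.map_source hE
  have hd1 : HasFDerivAt φ (fderiv ℝ φ l) l :=
    ((contMDiffAt_iff_contDiffAt.1 (contMDiffAt_of_mem_maximalAtlas hφ hl)).differentiableAt
      (by simp)).hasFDerivAt
  have hd2 : HasFDerivAt φ.symm (fderiv ℝ φ.symm 0) 0 :=
    ((contMDiffAt_iff_contDiffAt.1 (contMDiffAt_symm_of_mem_maximalAtlas hφ h0)).differentiableAt
      (by simp)).hasFDerivAt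
  have hsl : φ.symm 0 = l := by rw [← hφl, φ.left_inv hl]
  -- Hence the kernel vector of the model pulls back to a nonzero kernel vector of the differential
  -- of the exponential map.
  have hid : ∀ v, fderiv ℝ φ l (fderiv ℝ φ.symm 0 v) = v := by
    intro v
    have h1 : HasFDerivAt (φ ∘ φ.symm) ((fderiv ℝ φ l).comp (fderiv ℝ φ.symm 0)) 0 :=
      HasFDerivAt.comp 0 (by rwa [hsl]) hd2
    have h2 : HasFDerivAt (φ ∘ φ.symm) (ContinuousLinearMap.id ℝ R3) 0 :=
      (hasFDerivAt_id 0).congr_of_eventuallyEq (φ.eventually_right_inverse h0)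
    exact DFunLike.congr_fun (h1.unique h2) v
  have hd3 : HasMFDerivAt 𝓘(ℝ, R3) 𝓘(ℝ, R3) ψ.symm (0 : R3)
      (mfderiv 𝓘(ℝ, R3) 𝓘(ℝ, R3) ψ.symm (0 : R3)) :=
    ((contMDiffAt_symm_of_mem_maximalAtlas hψ h0').mdifferentiableAt (by simp)).hasMFDerivAt
  have hfφ : HasFDerivAt (f ∘ φ) (f'.comp (fderiv ℝ φ l)) l :=
    HasFDerivAt.comp l (by rwa [hφl]) hd1
  have hval : (f ∘ φ) l = 0 := by
    rw [Function.comp_apply, ← heq l hl, hψE]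
  have hcomp := HasMFDerivAt.comp l (g := ψ.symm) (f := f ∘ φ) (by rw [hval]; exact hd3)
    hfφ.hasMFDerivAt
  have hev : subExp q =ᶠ[𝓝 l] ψ.symm ∘ f ∘ φ := by
    filter_upwards [φ.open_source.mem_nhds hl] with x hx
    rw [Function.comp_apply, Function.comp_apply, ← heq x hx, ψ.left_inv (hmaps hx)]
  refine ⟨hdom hl, _, hcomp.congr_of_eventuallyEq hev, fderiv ℝ φ.symm 0 v, ?_, ?_⟩
  · intro hz
    apply hv
    rw [← hid v, hz, map_zero]
  · let D : R3 →L[ℝ] R3 := mfderiv 𝓘(ℝ, R3) 𝓘(ℝ, R3) ψ.symm (0 : R3)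
    have : D ((f'.comp (fderiv ℝ φ l)) (fderiv ℝ φ.symm 0 v)) = 0 := by
      rw [ContinuousLinearMap.comp_apply, hid, hfv, map_zero]
    exact this

/-! ### The explicit exponential map in linear coordinates -/

/-- The real part of `(u + i v) exp (-i w / 2)`. -/
noncomputable def rotU (l : Covector) : ℝ := l 1 * Real.cos (l 0 / 2) + l 2 * Real.sin (l 0 / 2)

/-- The imaginary part of `(u + i v) exp (-i w / 2)`. -/
noncomputable def rotV (l : Covector) : ℝ := l 2 * Real.cos (l 0 / 2) - l 1 * Real.sin (l 0 / 2)

/-- The coefficient `sin τ / τ`. -/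
noncomputable def sincTau (l : Covector) : ℝ := Real.sin (tau l) / tau l

/-- In complex form, `x₀ + i x₁ = (cos τ - i (w/2) sin τ / τ) exp(i w/2)` and `x₂ + i x₃ = (sin τ /
(2τ)) (u + i v) exp(-i w/2)`. -/
lemma lorentz_flowMatrix (l : Covector) :
    lorentz (flowMatrix l 1) =
      ![Real.cos (tau l) * Real.cos (l 0 / 2) + sincTau l * (l 0 / 2) * Real.sin (l 0 / 2),
        Real.cos (tau l) * Real.sin (l 0 / 2) - sincTau l * (l 0 / 2) * Real.cos (l 0 / 2),
        sincTau l / 2 * rotU l, sincTau l / 2 * rotV l] := by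
  ext k
  fin_cases k <;> simp [lorentz, flowMatrix, mul_apply_two, rotU, rotV, sincTau] <;> ring

lemma rotU_sq_add_rotV_sq (l : Covector) : rotU l ^ 2 + rotV l ^ 2 = l 1 ^ 2 + l 2 ^ 2 := by
  have h := Real.sin_sq_add_cos_sq (l 0 / 2)
  rw [rotU, rotV]
  linear_combination (l 1 ^ 2 + l 2 ^ 2) * h

lemma contDiff_rotU : ContDiff ℝ ∞ rotU := by
  unfold rotU
  fun_prop

lemma contDiff_rotV : ContDiff ℝ ∞ rotV := by
  unfold rotV
  fun_prop

lemma contDiffAt_sincTau {l : Covector} (hl : 0 < r l) : ContDiffAt ℝ ∞ sincTau l :=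
  (contDiffAt_tau hl).sin.div (contDiffAt_tau hl) (tau_pos hl).ne'

/-! Derivatives along the line `t ↦ l + t v`. -/

lemma hasDerivAt_line (l v : Covector) : HasDerivAt (fun t : ℝ => l + t • v) v 0 := by
  simpa using ((hasDerivAt_id (0 : ℝ)).smul_const v).const_add l

lemma hasDerivAt_line_apply (l v : Covector) (i : Fin 3) :
    HasDerivAt (fun t : ℝ => (l + t • v) i) (v i) 0 :=
  hasDerivAt_pi.1 (hasDerivAt_line l v) i

lemma hasDerivAt_tau_line {l : Covector} (hl : 0 < r l) (v : Covector) :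
    HasDerivAt (fun t : ℝ => tau (l + t • v))
      ((l 0 * v 0 - (l 1 * v 1 + l 2 * v 2)) / (4 * tau l)) 0 := by
  have h := hasDerivAt_line_apply l v
  have hr : HasDerivAt (fun t : ℝ => r (l + t • v)) _ 0 :=
    ((h 0).pow 2).sub (((h 1).pow 2).add ((h 2).pow 2))
  have hs := (hr.sqrt (by simpa using hl.ne')).div_const 2
  refine hs.congr_deriv ?_
  have hsq : √(r l) ≠ 0 := (Real.sqrt_pos.2 hl).ne'
  simp [tau]
  field_simp
  ring

lemma hasDerivAt_rotU_line (l v : Covector) :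
    HasDerivAt (fun t : ℝ => rotU (l + t • v))
      (v 1 * Real.cos (l 0 / 2) + v 2 * Real.sin (l 0 / 2) + rotV l * (v 0 / 2)) 0 := by
  have h := hasDerivAt_line_apply l v
  have h0 := (h 0).div_const 2
  refine (((h 1).mul h0.cos).add ((h 2).mul h0.sin)).congr_deriv ?_
  simp [rotV]
  ring

lemma hasDerivAt_rotV_line (l v : Covector) :
    HasDerivAt (fun t : ℝ => rotV (l + t • v))
      (v 2 * Real.cos (l 0 / 2) - v 1 * Real.sin (l 0 / 2) - rotU l * (v 0 / 2)) 0 := by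
  have h := hasDerivAt_line_apply l v
  have h0 := (h 0).div_const 2
  refine (((h 2).mul h0.cos).sub ((h 1).mul h0.sin)).congr_deriv ?_
  simp [rotU]
  ring

lemma hasDerivAt_sincTau_line {l : Covector} (hl : 0 < r l) (v : Covector) :
    HasDerivAt (fun t : ℝ => sincTau (l + t • v))
      ((Real.cos (tau l) - sincTau l) / tau l *
        ((l 0 * v 0 - (l 1 * v 1 + l 2 * v 2)) / (4 * tau l))) 0 := by
  have h := hasDerivAt_tau_line hl v
  have hτ := (tau_pos hl).ne'
  refine (h.sin.div h (by simpa using hτ)).congr_deriv ?_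
  simp [sincTau]
  field_simp

/-! ### The first caustic -/

lemma expEquivalentNear_of_mem_C1 (q : SL2) {l : Covector} (hl : l ∈ C1) :
    ExpEquivalentNear q l (fun p => ![p 0 * p 2, p 1, p 2]) := by
  obtain ⟨hH, hr, hs⟩ := hl
  change Real.sin (tau l) = 0 at hs
  have hk : sincTau l = 0 := by rw [sincTau, hs, zero_div]
  have hτ := (tau_pos hr).ne'
  have huv : l 1 ^ 2 + l 2 ^ 2 ≠ 0 := fun h => hH (by rw [hamiltonian, h, mul_zero])
  have hc : Real.cos (tau l) ^ 2 = 1 := by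
    have := Real.sin_sq_add_cos_sq (tau l)
    rw [hs] at this
    linarith
  have hc0 : Real.cos (tau l) ≠ 0 := by
    intro h
    rw [h] at hc
    norm_num at hc
  have hCS := Real.sin_sq_add_cos_sq (l 0 / 2)
  set c := Real.cos (tau l) with hcdef
  set a₀ := c * Real.cos (l 0 / 2) with ha₀
  set a₁ := c * Real.sin (l 0 / 2) with ha₁
  have ha : a₀ ^ 2 + a₁ ^ 2 = 1 := by
    rw [ha₀, ha₁]
    linear_combination c ^ 2 * hCS + hc
  set b₁ := rotU l with hb₁
  set b₂ := rotV l with hb₂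
  have hb : b₁ ^ 2 + b₂ ^ 2 = l 1 ^ 2 + l 2 ^ 2 := rotU_sq_add_rotV_sq l
  have hb0 : b₁ ^ 2 + b₂ ^ 2 ≠ 0 := hb ▸ huv
  have hx₀ : lorentz (flowMatrix l 1) = ![a₀, a₁, 0, 0] := by
    rw [lorentz_flowMatrix, hk]
    ext k
    fin_cases k <;> simp [a₀, a₁, c]
  -- With `β = rotU + i rotV` and `a` the complex number formed by the first two coordinates of the
  -- endpoint, `P` and `N` are the real and imaginary parts of `β(x)` times the conjugate of `β(l)`,
  -- and `Y` is the imaginary part of `a(x)` times the conjugate of `a(l)`.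
  let P : R3 → ℝ := fun x => rotU x * b₁ + rotV x * b₂
  let N : R3 → ℝ := fun x => rotV x * b₁ - rotU x * b₂
  let Y : R3 → ℝ := fun x =>
    (Real.cos (tau x) * Real.sin (x 0 / 2) - sincTau x * (x 0 / 2) * Real.cos (x 0 / 2)) * a₀ -
    (Real.cos (tau x) * Real.cos (x 0 / 2) + sincTau x * (x 0 / 2) * Real.sin (x 0 / 2)) * a₁
  have hP : ContDiff ℝ ∞ P := (contDiff_rotU.mul contDiff_const).add
    (contDiff_rotV.mul contDiff_const)
  have hN : ContDiff ℝ ∞ N := (contDiff_rotV.mul contDiff_const).sub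
    (contDiff_rotU.mul contDiff_const)
  have hPl : P l = b₁ ^ 2 + b₂ ^ 2 := by simp only [P]; ring
  have hNl : N l = 0 := by simp only [N]; ring
  -- The normal form is the identity `(k/2) N = (N / P) · ((k/2) P)` with `k = sincTau`.
  refine expEquivalentNear_of_eq q hr (U := {x | 0 < r x} ∩ {x | P x ≠ 0})
    (Φ := fun x => ![N x / P x, Y x, sincTau x / 2 * P x])
    (g := fun y => ![y 3 * b₁ - y 2 * b₂, y 1 * a₀ - y 0 * a₁, y 2 * b₁ + y 3 * b₂])
    (isOpen_r_pos.inter (isOpen_ne_fun hP.continuous continuous_const))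
    ⟨hr, hPl.trans_ne hb0⟩ ?_ ?_ ?_ ?_ ?_ ?_ ?_
  · rintro x ⟨hx, hPx⟩
    have ht : ContDiffAt ℝ ∞ tau x := contDiffAt_tau hx
    have hsx : ContDiffAt ℝ ∞ sincTau x := contDiffAt_sincTau hx
    have hPx' : P x ≠ 0 := hPx
    refine (contDiffAt_pi.2 fun k => ?_).contDiffWithinAt
    fin_cases k
    · exact hN.contDiffAt.div hP.contDiffAt hPx'
    · change ContDiffAt ℝ ∞ Y x
      simp only [Y]
      fun_prop
    · exact (hsx.div_const 2).mul hP.contDiffAt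
  · ext k
    fin_cases k
    · simp [hNl]
    · simp [Y, hk, ha₀, ha₁, c]
      ring
    · simp [hk]
  · intro v hv
    rw [hasDerivAt_pi] at hv
    have v0 : HasDerivAt (fun t : ℝ => N (l + t • v) / P (l + t • v)) 0 0 := hv 0
    have v1 : HasDerivAt (fun t : ℝ => Y (l + t • v)) 0 0 := hv 1
    have v2 : HasDerivAt (fun t : ℝ => sincTau (l + t • v) / 2 * P (l + t • v)) 0 0 := hv 2
    have dU := hasDerivAt_rotU_line l v
    have dV := hasDerivAt_rotV_line l v
    have dt := hasDerivAt_tau_line hr v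
    have dk := hasDerivAt_sincTau_line hr v
    have d0 := (hasDerivAt_line_apply l v 0).div_const 2
    have dP : HasDerivAt (fun t : ℝ => P (l + t • v)) _ 0 :=
      (dU.mul_const b₁).add (dV.mul_const b₂)
    have dN : HasDerivAt (fun t : ℝ => N (l + t • v)) _ 0 :=
      (dV.mul_const b₁).sub (dU.mul_const b₂)
    have e2 := v2.unique ((dk.div_const 2).mul dP)
    simp only [zero_smul, add_zero, hk, hPl, sub_zero, zero_div, zero_mul] at e2
    -- Since `k` vanishes at `l` with nonzero derivative in `τ`, stationarity of `(k/2) P` forces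
    -- `τ` to be stationary. After that `Y` only sees `v 0`, and `N / P` only the component of `(v
    -- 1, v 2)` orthogonal to `(u, v)`.
    have hrad : l 0 * v 0 - (l 1 * v 1 + l 2 * v 2) = 0 := by
      have h := e2.symm
      simpa [hτ, hc0, hb0, ← hcdef] using h
    rw [hrad] at dt dk
    have e1 := v1.unique ((((dt.cos.mul d0.sin).sub ((dk.mul d0).mul d0.cos)).mul_const a₀).sub
      (((dt.cos.mul d0.cos).add ((dk.mul d0).mul d0.sin)).mul_const a₁))
    simp [hk, hs, ← hcdef] at e1
    have hv0 : v 0 = 0 := by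
      have : (a₀ ^ 2 + a₁ ^ 2) * v 0 = 0 := by
        rw [ha₀, ha₁]
        rw [ha₀, ha₁] at e1
        linear_combination -2 * e1
      rwa [ha, one_mul] at this
    have e0 := v0.unique (dN.div dP (by simpa [hPl] using hb0))
    simp [hNl, hPl, hv0] at e0
    rw [eq_comm, div_eq_zero_iff, mul_eq_zero] at e0
    have e0' := (e0.resolve_right (pow_ne_zero 2 hb0)).resolve_right hb0
    have hcross : l 1 * v 2 - l 2 * v 1 = 0 := by
      rw [hb₁, hb₂, rotU, rotV] at e0'
      linear_combination e0' - (l 1 * v 2 - l 2 * v 1) * hCS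
    rw [hv0, mul_zero, zero_sub, neg_eq_zero] at hrad
    have hv1 : (l 1 ^ 2 + l 2 ^ 2) * v 1 = 0 := by
      linear_combination l 1 * hrad - l 2 * hcross
    have hv2 : (l 1 ^ 2 + l 2 ^ 2) * v 2 = 0 := by
      linear_combination l 2 * hrad + l 1 * hcross
    ext k
    fin_cases k
    · exact hv0
    · exact (mul_eq_zero.1 hv1).resolve_left huv
    · exact (mul_eq_zero.1 hv2).resolve_left huv
  · refine contDiff_pi.2 fun k => ?_
    fin_cases k <;> simp <;> fun_prop
  · rw [hx₀]
    ext k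
    fin_cases k <;> simp
    ring
  · intro y a hy hya hg hq
    rw [hx₀] at hy
    rw [hasDerivAt_pi] at hya hg
    have g0 := (hg 0).unique (((hya 3).mul_const b₁).sub ((hya 2).mul_const b₂))
    have g1 := (hg 1).unique (((hya 1).mul_const a₀).sub ((hya 0).mul_const a₁))
    have g2 := (hg 2).unique (((hya 2).mul_const b₁).add ((hya 3).mul_const b₂))
    simp [hy] at g0 g1 g2 hq
    have h2 : (b₁ ^ 2 + b₂ ^ 2) * a 2 = 0 := by linear_combination b₂ * g0 - b₁ * g2
    have h3 : (b₁ ^ 2 + b₂ ^ 2) * a 3 = 0 := by linear_combination -b₁ * g0 - b₂ * g2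
    have h1 : a 1 = 0 := by linear_combination -a₀ * g1 + a₁ * hq - a 1 * ha
    have h0 : a 0 = 0 := by linear_combination a₁ * g1 + a₀ * hq - a 0 * ha
    ext k
    fin_cases k
    · exact h0
    · exact h1
    · exact (mul_eq_zero.1 h2).resolve_left hb0
    · exact (mul_eq_zero.1 h3).resolve_left hb0
  · rintro x ⟨-, hPx⟩ -
    have hPx' : P x ≠ 0 := hPx
    rw [lorentz_flowMatrix]
    ext k
    fin_cases k
    · simp [N]
      field_simp
    · simp [Y]
    · simp [P]
      ring

/-! ### The fold -/

/-- The ratio `w / (2 τ)` as a function of the last two linear coordinates `b` of the endpoint and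
of `τ`; the sign `ε` is that of `w`. -/
noncomputable def ratio (ε : ℝ) (b : ℝ × ℝ) (τ : ℝ) : ℝ :=
  ε * √(1 + (b.1 ^ 2 + b.2 ^ 2) / Real.sin τ ^ 2)

/-- The first linear coordinate of the endpoint, as a function of `b` and `τ`. -/
noncomputable def endRe (ε : ℝ) (b : ℝ × ℝ) (τ : ℝ) : ℝ :=
  Real.cos τ * Real.cos (τ * ratio ε b τ) +
    ratio ε b τ * Real.sin τ * Real.sin (τ * ratio ε b τ)

/-- The second linear coordinate of the endpoint, as a function of `b` and `τ`. -/
noncomputable def endIm (ε : ℝ) (b : ℝ × ℝ) (τ : ℝ) : ℝ :=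
  Real.cos τ * Real.sin (τ * ratio ε b τ) -
    ratio ε b τ * Real.sin τ * Real.cos (τ * ratio ε b τ)

/-- The angular velocity of the point with coordinates `endRe`, `endIm`, as `τ` varies, divided by
`sin τ - τ cos τ`. -/
noncomputable def angular (ε : ℝ) (b : ℝ × ℝ) (τ : ℝ) : ℝ :=
  (b.1 ^ 2 + b.2 ^ 2) / (ratio ε b τ * Real.sin τ ^ 3)

lemma one_add_div_sin_sq_pos (b : ℝ × ℝ) (τ : ℝ) :
    0 < 1 + (b.1 ^ 2 + b.2 ^ 2) / Real.sin τ ^ 2 := by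
  positivity

lemma ratio_sq {ε : ℝ} (hε : ε ^ 2 = 1) (b : ℝ × ℝ) (τ : ℝ) :
    ratio ε b τ ^ 2 = 1 + (b.1 ^ 2 + b.2 ^ 2) / Real.sin τ ^ 2 := by
  rw [ratio, mul_pow, hε, one_mul, Real.sq_sqrt (one_add_div_sin_sq_pos b τ).le]

lemma ratio_ne_zero {ε : ℝ} (hε : ε ^ 2 = 1) (b : ℝ × ℝ) (τ : ℝ) : ratio ε b τ ≠ 0 := by
  intro h
  have h1 := ratio_sq hε b τ
  have h2 := one_add_div_sin_sq_pos b τ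
  rw [h] at h1
  linarith

lemma contDiffAt_ratio {E : Type*} [NormedAddCommGroup E] [NormedSpace ℝ E] {ε : ℝ}
    {b : E → ℝ × ℝ} {τ : E → ℝ} {x : E} (hb : ContDiffAt ℝ ∞ b x) (hτ : ContDiffAt ℝ ∞ τ x)
    (hs : Real.sin (τ x) ≠ 0) : ContDiffAt ℝ ∞ (fun y => ratio ε (b y) (τ y)) x := by
  unfold ratio
  refine contDiffAt_const.mul (ContDiffAt.sqrt ?_ (one_add_div_sin_sq_pos _ _).ne')
  exact contDiffAt_const.add (((hb.fst.pow 2).add (hb.snd.pow 2)).div (hτ.sin.pow 2)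
    (pow_ne_zero 2 hs))

lemma contDiffAt_endRe {E : Type*} [NormedAddCommGroup E] [NormedSpace ℝ E] {ε : ℝ}
    {b : E → ℝ × ℝ} {τ : E → ℝ} {x : E} (hb : ContDiffAt ℝ ∞ b x) (hτ : ContDiffAt ℝ ∞ τ x)
    (hs : Real.sin (τ x) ≠ 0) : ContDiffAt ℝ ∞ (fun y => endRe ε (b y) (τ y)) x := by
  have h : ContDiffAt ℝ ∞ (fun y => ratio ε (b y) (τ y)) x := contDiffAt_ratio hb hτ hs
  exact (hτ.cos.mul (hτ.mul h).cos).add ((h.mul hτ.sin).mul (hτ.mul h).sin)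

lemma contDiffAt_endIm {E : Type*} [NormedAddCommGroup E] [NormedSpace ℝ E] {ε : ℝ}
    {b : E → ℝ × ℝ} {τ : E → ℝ} {x : E} (hb : ContDiffAt ℝ ∞ b x) (hτ : ContDiffAt ℝ ∞ τ x)
    (hs : Real.sin (τ x) ≠ 0) : ContDiffAt ℝ ∞ (fun y => endIm ε (b y) (τ y)) x := by
  have h : ContDiffAt ℝ ∞ (fun y => ratio ε (b y) (τ y)) x := contDiffAt_ratio hb hτ hs
  exact (hτ.cos.mul (hτ.mul h).sin).sub ((h.mul hτ.sin).mul (hτ.mul h).cos)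

lemma endRe_sq_add_endIm_sq {ε : ℝ} (hε : ε ^ 2 = 1) (b : ℝ × ℝ) {τ : ℝ}
    (hs : Real.sin τ ≠ 0) : endRe ε b τ ^ 2 + endIm ε b τ ^ 2 = 1 + (b.1 ^ 2 + b.2 ^ 2) := by
  have h1 := ratio_sq hε b τ
  have h2 := Real.sin_sq_add_cos_sq τ
  have h3 := Real.sin_sq_add_cos_sq (τ * ratio ε b τ)
  have h4 : ratio ε b τ ^ 2 * Real.sin τ ^ 2 = Real.sin τ ^ 2 + (b.1 ^ 2 + b.2 ^ 2) := by
    rw [h1]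
    field_simp
  rw [endRe, endIm]
  linear_combination (Real.cos τ ^ 2 + ratio ε b τ ^ 2 * Real.sin τ ^ 2) * h3 + h4 + h2

lemma hasDerivAt_ratio {ε : ℝ} (hε : ε ^ 2 = 1) (b : ℝ × ℝ) {τ : ℝ} (hs : Real.sin τ ≠ 0) :
    HasDerivAt (ratio ε b) (-(angular ε b τ * Real.cos τ)) τ := by
  have hq : √(1 + (b.1 ^ 2 + b.2 ^ 2) / Real.sin τ ^ 2) ≠ 0 :=
    (Real.sqrt_pos.2 (one_add_div_sin_sq_pos b τ)).ne'
  have hε0 : ε ≠ 0 := by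
    rintro rfl
    norm_num at hε
  have h := ((((hasDerivAt_const τ (b.1 ^ 2 + b.2 ^ 2)).div ((Real.hasDerivAt_sin τ).pow 2)
    (pow_ne_zero 2 hs)).const_add 1).sqrt (one_add_div_sin_sq_pos b τ).ne').const_mul ε
  refine h.congr_deriv ?_
  simp only [angular, ratio, Pi.pow_apply, Pi.div_apply, Nat.cast_ofNat, Nat.add_one_sub_one, pow_one]
  field_simp
  linear_combination -2 * (b.1 ^ 2 + b.2 ^ 2) * Real.cos τ * hε

/-- With `Q = ratio ε b τ` and `a = (cos τ - i Q sin τ) exp(i τ Q)`, the left side is the real part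
of `a' exp(-i τ Q)`; its imaginary part is `-Q' (sin τ - τ cos τ)`. The identity gives `a' = i ω a`,
where `ω` is `angular` times `sin τ - τ cos τ`. -/
lemma angular_identity {ε : ℝ} (hε : ε ^ 2 = 1) (b : ℝ × ℝ) {τ : ℝ} (hs : Real.sin τ ≠ 0) :
    -Real.sin τ + ratio ε b τ * Real.sin τ *
        (ratio ε b τ + τ * -(angular ε b τ * Real.cos τ)) =
      angular ε b τ * (Real.sin τ - τ * Real.cos τ) * (ratio ε b τ * Real.sin τ) := by
  have h1 : ratio ε b τ ^ 2 * Real.sin τ ^ 2 = Real.sin τ ^ 2 + (b.1 ^ 2 + b.2 ^ 2) := by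
    rw [ratio_sq hε]
    field_simp
  have hq := ratio_ne_zero hε b τ
  have h2 : angular ε b τ * (ratio ε b τ * Real.sin τ ^ 3) = b.1 ^ 2 + b.2 ^ 2 := by
    rw [angular]
    field_simp
  apply mul_right_cancel₀ hs
  linear_combination h1 - h2

lemma hasDerivAt_endRe {ε : ℝ} (hε : ε ^ 2 = 1) (b : ℝ × ℝ) {τ : ℝ} (hs : Real.sin τ ≠ 0) :
    HasDerivAt (endRe ε b)
      (-(angular ε b τ * (Real.sin τ - τ * Real.cos τ) * endIm ε b τ)) τ := by
  have hQ := hasDerivAt_ratio hε b hs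
  have hθ := (hasDerivAt_id τ).mul hQ
  have h1 := angular_identity hε b hs
  refine (((Real.hasDerivAt_cos τ).mul hθ.cos).add
    ((hQ.mul (Real.hasDerivAt_sin τ)).mul hθ.sin)).congr_deriv ?_
  simp only [endIm, Pi.mul_apply, id]
  linear_combination Real.cos (τ * ratio ε b τ) * h1

lemma hasDerivAt_endIm {ε : ℝ} (hε : ε ^ 2 = 1) (b : ℝ × ℝ) {τ : ℝ} (hs : Real.sin τ ≠ 0) :
    HasDerivAt (endIm ε b)
      (angular ε b τ * (Real.sin τ - τ * Real.cos τ) * endRe ε b τ) τ := by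
  have hQ := hasDerivAt_ratio hε b hs
  have hθ := (hasDerivAt_id τ).mul hQ
  have h1 := angular_identity hε b hs
  refine (((Real.hasDerivAt_cos τ).mul hθ.sin).sub
    ((hQ.mul (Real.hasDerivAt_sin τ)).mul hθ.cos)).congr_deriv ?_
  simp only [endRe, Pi.mul_apply, id]
  linear_combination Real.sin (τ * ratio ε b τ) * h1

/-- Near a zero `τ₀` of `sin τ - τ cos τ`, the area spanned by the points with parameters `τ₀` and
`τ` has a nondegenerate double zero. -/
lemma exists_endpoint_area_eq_sq_mul {ε τ₀ δ : ℝ} (hε : ε ^ 2 = 1) (hδ : 0 < δ)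
    (hs : ∀ τ, |τ - τ₀| ≤ δ → Real.sin τ ≠ 0) (hτ₀ : Real.sin τ₀ - τ₀ * Real.cos τ₀ = 0)
    (hτ₀' : τ₀ ≠ 0) :
    ∃ h : (ℝ × ℝ) × ℝ → ℝ, ContDiff ℝ ∞ h ∧ (∀ b, b.1 ^ 2 + b.2 ^ 2 ≠ 0 → h (b, 0) ≠ 0) ∧
      ∀ b t, endIm ε b (τ₀ + δ * Real.sin t) * endRe ε b τ₀ -
        endRe ε b (τ₀ + δ * Real.sin t) * endIm ε b τ₀ = t ^ 2 * h (b, t) := by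
  -- The substitution `τ = τ₀ + δ sin t` keeps `τ` away from the zeros of `sin` for every real `t`,
  -- so the area is smooth on the whole space, as Hadamard's lemma requires.
  have hst : ∀ t, Real.sin (τ₀ + δ * Real.sin t) ≠ 0 := by
    intro t
    apply hs
    rw [add_sub_cancel_left, abs_mul, abs_of_pos hδ]
    exact mul_le_of_le_one_right hδ.le (Real.abs_sin_le_one t)
  have hs₀ : Real.sin τ₀ ≠ 0 := by simpa using hst 0
  have hg : ∀ t, HasDerivAt (fun t => τ₀ + δ * Real.sin t) (δ * Real.cos t) t := fun t =>
    ((Real.hasDerivAt_sin t).const_mul δ).const_add τ₀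
  let f : (ℝ × ℝ) × ℝ → ℝ := fun x => endIm ε x.1 (τ₀ + δ * Real.sin x.2) * endRe ε x.1 τ₀ -
    endRe ε x.1 (τ₀ + δ * Real.sin x.2) * endIm ε x.1 τ₀
  have hf : ContDiff ℝ ∞ f := by
    rw [contDiff_iff_contDiffAt]
    intro x
    have h1 : ContDiffAt ℝ ∞ (fun x : (ℝ × ℝ) × ℝ => τ₀ + δ * Real.sin x.2) x := by fun_prop
    exact ((contDiffAt_endIm contDiffAt_fst h1 (hst _)).mul
      (contDiffAt_endRe contDiffAt_fst contDiffAt_const hs₀)).sub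
      ((contDiffAt_endRe contDiffAt_fst h1 (hst _)).mul
      (contDiffAt_endIm contDiffAt_fst contDiffAt_const hs₀))
  let m : ℝ × ℝ → ℝ → ℝ := fun b t =>
    angular ε b (τ₀ + δ * Real.sin t) * (δ * Real.cos t) *
      (endRe ε b (τ₀ + δ * Real.sin t) * endRe ε b τ₀ +
        endIm ε b (τ₀ + δ * Real.sin t) * endIm ε b τ₀)
  -- The factor `sin τ - τ cos τ` has a simple zero at `t = 0`, so the second derivative of the area
  -- there is `τ₀ sin τ₀ δ` times `m b 0`. At `t = 0` the last factor of `m` is `1 + |b|²`.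
  let D : ℝ × ℝ → ℝ → ℝ := fun b t =>
    (Real.sin (τ₀ + δ * Real.sin t) - (τ₀ + δ * Real.sin t) * Real.cos (τ₀ + δ * Real.sin t)) *
      m b t
  have hfD : ∀ b t, HasDerivAt (fun t => f (b, t)) (D b t) t := by
    intro b t
    have h1 := (hasDerivAt_endIm hε b (hst t)).comp t (hg t)
    have h2 := (hasDerivAt_endRe hε b (hst t)).comp t (hg t)
    refine ((h1.mul_const (endRe ε b τ₀)).sub (h2.mul_const (endIm ε b τ₀))).congr_deriv ?_
    simp only [D, m]
    ring
  have hD0 : ∀ b, D b 0 = 0 := by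
    intro b
    simp [D, hτ₀]
  obtain ⟨h, hh, hfh⟩ := exists_contDiff_eq_sq_mul hf
    (fun b => by simp only [f, Real.sin_zero, mul_zero, add_zero]; ring)
    (fun b => (hfD b 0).congr_deriv (hD0 b))
  refine ⟨h, hh, fun b hb => ?_, hfh⟩
  have hm : DifferentiableAt ℝ (m b) 0 := by
    have hid : ContDiffAt ℝ ∞ (fun t : ℝ => τ₀ + δ * Real.sin t) 0 := by fun_prop
    have hb : ContDiffAt ℝ ∞ (fun _ : ℝ => b) 0 := contDiffAt_const
    have hr : ContDiffAt ℝ ∞ (fun t : ℝ => angular ε b (τ₀ + δ * Real.sin t)) 0 :=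
      contDiffAt_const.div ((contDiffAt_ratio hb hid (hst 0)).mul (hid.sin.pow 3))
        (mul_ne_zero (ratio_ne_zero hε _ _) (pow_ne_zero 3 (hst 0)))
    have hc : ContDiffAt ℝ ∞ (fun t : ℝ => δ * Real.cos t) 0 := by fun_prop
    exact ((hr.mul hc).mul (((contDiffAt_endRe hb hid (hst 0)).mul contDiffAt_const).add
      ((contDiffAt_endIm hb hid (hst 0)).mul contDiffAt_const))).differentiableAt (by simp)
  have hφ : HasDerivAt (fun t => Real.sin (τ₀ + δ * Real.sin t) -
      (τ₀ + δ * Real.sin t) * Real.cos (τ₀ + δ * Real.sin t)) (τ₀ * Real.sin τ₀ * δ) 0 := by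
    refine ((hg 0).sin.sub ((hg 0).mul (hg 0).cos)).congr_deriv ?_
    simp
    ring
  have hDd : HasDerivAt (D b) (τ₀ * Real.sin τ₀ * δ * m b 0) 0 := by
    refine (hφ.mul hm.hasDerivAt).congr_deriv ?_
    simp [hτ₀]
  have h2 := two_mul_eq_of_hasDerivAt_sq_mul (h := fun t => h (b, t)) (D := D b)
    (hh.comp (contDiff_prodMk_right b)) (fun t => ?_) hDd
  · intro h0
    rw [h0, mul_zero] at h2
    refine mul_ne_zero (mul_ne_zero (mul_ne_zero hτ₀' hs₀) hδ.ne') ?_ h2.symm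
    have hR := endRe_sq_add_endIm_sq hε b hs₀
    simp only [m, Real.sin_zero, mul_zero, add_zero, Real.cos_zero, mul_one, ← pow_two, hR]
    refine mul_ne_zero (mul_ne_zero (div_ne_zero hb (mul_ne_zero (ratio_ne_zero hε _ _)
      (pow_ne_zero 3 hs₀))) hδ.ne') ?_
    positivity
  · exact (hfD b t).congr_of_eventuallyEq (Eventually.of_forall fun t => (hfh b t).symm)

/-- The last two linear coordinates of the endpoint. -/
noncomputable def endB (l : Covector) : ℝ × ℝ := (sincTau l / 2 * rotU l, sincTau l / 2 * rotV l)

lemma contDiffAt_endB {l : Covector} (hl : 0 < r l) : ContDiffAt ℝ ∞ endB l :=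
  (((contDiffAt_sincTau hl).div_const 2).mul contDiff_rotU.contDiffAt).prodMk
    (((contDiffAt_sincTau hl).div_const 2).mul contDiff_rotV.contDiffAt)

/-- From `|b|² = sin² τ (u² + v²) / (4τ²)` and `u² + v² = w² - 4τ²` one gets `1 + |b|² / sin² τ = (w
/ (2τ))²`; the sign `ε` selects the root. -/
lemma two_mul_tau_mul_ratio {ε : ℝ} (hε : ε ^ 2 = 1) {l : Covector} (hl : 0 < r l)
    (hw : 0 < ε * l 0) (hs : Real.sin (tau l) ≠ 0) : tau l * ratio ε (endB l) (tau l) = l 0 / 2 := by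
  have hτ := tau_pos hl
  have h4 := four_mul_tau_sq hl
  have hB := rotU_sq_add_rotV_sq l
  have h1 : 1 + ((endB l).1 ^ 2 + (endB l).2 ^ 2) / Real.sin (tau l) ^ 2 =
      (ε * l 0 / (2 * tau l)) ^ 2 := by
    have h2 : (endB l).1 ^ 2 + (endB l).2 ^ 2 =
        Real.sin (tau l) ^ 2 / (4 * tau l ^ 2) * (l 1 ^ 2 + l 2 ^ 2) := by
      rw [← hB, endB, sincTau]
      field_simp
      ring
    rw [h2]
    field_simp
    linear_combination 4 * h4 - 4 * l 0 ^ 2 * hε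
  rw [ratio, h1, Real.sqrt_sq (by positivity)]
  field_simp
  linear_combination l 0 * hε

lemma lorentz_flowMatrix_eq_end {ε : ℝ} (hε : ε ^ 2 = 1) {l : Covector} (hl : 0 < r l)
    (hw : 0 < ε * l 0) (hs : Real.sin (tau l) ≠ 0) :
    lorentz (flowMatrix l 1) =
      ![endRe ε (endB l) (tau l), endIm ε (endB l) (tau l), (endB l).1, (endB l).2] := by
  have h := two_mul_tau_mul_ratio hε hl hw hs
  have hτ := (tau_pos hl).ne'
  have h2 : sincTau l * (l 0 / 2) = ratio ε (endB l) (tau l) * Real.sin (tau l) := by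
    rw [← h, sincTau]
    field_simp
  rw [lorentz_flowMatrix, endRe, endIm, h, h2, endB]

lemma expEquivalentNear_of_mem_C0 (q : SL2) {l : Covector} (hl : l ∈ C0) :
    ExpEquivalentNear q l (fun p => ![p 0 ^ 2, p 1, p 2]) := by
  obtain ⟨hH, hr, hcaus⟩ := hl
  have hτ := tau_pos hr
  have h4 := four_mul_tau_sq hr
  have huv : l 1 ^ 2 + l 2 ^ 2 ≠ 0 := fun h => hH (by rw [hamiltonian, h, mul_zero])
  have hw : l 0 ≠ 0 := by
    intro h
    rw [h] at h4
    nlinarith [sq_nonneg (l 1), sq_nonneg (l 2), pow_pos hτ 2]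
  set τ₀ := tau l with hτdef
  have hτ₀ : Real.sin τ₀ - τ₀ * Real.cos τ₀ = 0 := by
    have h : √(r l) = 2 * τ₀ := by rw [hτdef, tau]; ring
    rw [h, mul_div_cancel_left₀ _ two_ne_zero] at hcaus
    linarith
  have hs₀ : Real.sin τ₀ ≠ 0 := by
    intro h
    rw [h, zero_sub, neg_eq_zero] at hτ₀
    have hc := (mul_eq_zero.1 hτ₀).resolve_left hτ.ne'
    have := Real.sin_sq_add_cos_sq τ₀
    rw [h, hc] at this
    norm_num at this
  obtain ⟨ε, hε, hεw⟩ : ∃ ε : ℝ, ε ^ 2 = 1 ∧ 0 < ε * l 0 := by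
    rcases lt_or_gt_of_ne hw with h | h
    · exact ⟨-1, by norm_num, by linarith⟩
    · exact ⟨1, by norm_num, by linarith⟩
  obtain ⟨δ, hδ, hδs⟩ : ∃ δ > 0, ∀ τ, |τ - τ₀| ≤ δ → Real.sin τ ≠ 0 := by
    have hev : ∀ᶠ τ in 𝓝 τ₀, Real.sin τ ≠ 0 := Real.continuous_sin.continuousAt.eventually_ne hs₀
    obtain ⟨δ, hδ, h⟩ := Metric.nhds_basis_closedBall.eventually_iff.1 hev
    exact ⟨δ, hδ, fun τ hτ => h (by rwa [Metric.mem_closedBall, Real.dist_eq])⟩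
  obtain ⟨h, hh, hh0, hT⟩ := exists_endpoint_area_eq_sq_mul hε hδ hδs hτ₀ hτ.ne'
  have hk0 : sincTau l ≠ 0 := div_ne_zero hs₀ hτ.ne'
  set b := endB l with hb
  have hb0 : b.1 ^ 2 + b.2 ^ 2 ≠ 0 := by
    have : b.1 ^ 2 + b.2 ^ 2 = (sincTau l / 2) ^ 2 * (l 1 ^ 2 + l 2 ^ 2) := by
      rw [hb, endB, ← rotU_sq_add_rotV_sq]
      ring
    rw [this]
    exact mul_ne_zero (pow_ne_zero 2 (div_ne_zero hk0 two_ne_zero)) huv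
  -- The sign `σ` is put into the target chart, so that `σ h` is positive near `l` and has a smooth
  -- square root.
  obtain ⟨σ, hσ, hσh⟩ : ∃ σ : ℝ, σ ^ 2 = 1 ∧ 0 < σ * h (b, 0) := by
    rcases lt_or_gt_of_ne (hh0 b hb0) with h | h
    · exact ⟨-1, by norm_num, by linarith⟩
    · exact ⟨1, by norm_num, by linarith⟩
  have hx₀ := lorentz_flowMatrix_eq_end hε hr hεw hs₀
  rw [← hb, ← hτdef] at hx₀
  -- Inverse of the substitution `τ = τ₀ + δ sin t`.
  let s : R3 → ℝ := fun x => Real.arcsin ((tau x - τ₀) / δ)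
  let F : R3 → ℝ := fun x => σ * h (endB x, s x)
  let U₁ : Set R3 := {x | 0 < r x} ∩ tau ⁻¹' Metric.ball τ₀ δ
  have htc : ContinuousOn tau {x | 0 < r x} := fun x hx =>
    (contDiffAt_tau hx).continuousAt.continuousWithinAt
  have hU₁ : IsOpen U₁ := htc.isOpen_inter_preimage isOpen_r_pos Metric.isOpen_ball
  have hU₁δ : ∀ x ∈ U₁, |tau x - τ₀| < δ := fun x hx => by
    have := hx.2
    rwa [mem_preimage, Metric.mem_ball, Real.dist_eq] at this
  have hssm : ∀ x ∈ U₁, ContDiffAt ℝ ∞ s x := by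
    intro x hx
    have hlt := abs_lt.1 (hU₁δ x hx)
    have h1 : (tau x - τ₀) / δ ≠ -1 := by
      rw [Ne, div_eq_iff hδ.ne']
      linarith
    have h2 : (tau x - τ₀) / δ ≠ 1 := by
      rw [Ne, div_eq_iff hδ.ne']
      linarith
    exact ContDiffAt.comp x (g := Real.arcsin) (Real.contDiffAt_arcsin h1 h2)
      (((contDiffAt_tau hx.1).sub contDiffAt_const).div_const δ)
  have hFsm : ∀ x ∈ U₁, ContDiffAt ℝ ∞ F x := fun x hx =>
    contDiffAt_const.mul
      (hh.contDiffAt.comp x ((contDiffAt_endB hx.1).prodMk (hssm x hx)))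
  have hFc : ContinuousOn F U₁ := fun x hx => (hFsm x hx).continuousAt.continuousWithinAt
  have hsl : s l = 0 := by simp [s, ← hτdef]
  have hFl : F l = σ * h (b, 0) := by simp only [F, hsl, ← hb]
  have hlU₁ : l ∈ U₁ := ⟨hr, Metric.mem_ball_self hδ⟩
  -- The first target coordinate is `σ` times the area spanned by `a(b, τ₀)`, the turning point for
  -- the same `b`, and the endpoint; it equals `s² F`, the square of `s √F`.
  refine expEquivalentNear_of_eq q hr
    (U := (U₁ ∩ F ⁻¹' Ioi 0) ∩ {x | 0 < ε * x 0})
    (Φ := fun x => ![s x * √(F x), (endB x).1 - b.1, (endB x).2 - b.2])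
    (g := fun y => ![σ * (y 1 * endRe ε (y 2, y 3) τ₀ - y 0 * endIm ε (y 2, y 3) τ₀),
      y 2 - b.1, y 3 - b.2])
    ((hFc.isOpen_inter_preimage hU₁ isOpen_Ioi).inter
      (isOpen_lt continuous_const (continuous_const.mul (continuous_apply 0))))
    ⟨⟨hlU₁, hσh.trans_eq hFl.symm⟩, hεw⟩ ?_ ?_ ?_ ?_ ?_ ?_ ?_
  · rintro x ⟨⟨hx, hFx⟩, -⟩
    have hFx' : F x ≠ 0 := ne_of_gt hFx
    have hB := contDiffAt_endB hx.1
    refine (contDiffAt_pi.2 fun k => ?_).contDiffWithinAt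
    fin_cases k
    · exact (hssm x hx).mul ((hFsm x hx).sqrt hFx')
    · exact hB.fst.sub contDiffAt_const
    · exact hB.snd.sub contDiffAt_const
  · ext k
    fin_cases k <;> simp [hsl, ← hb]
  · intro v hv
    rw [hasDerivAt_pi] at hv
    have v0 : HasDerivAt (fun t : ℝ => s (l + t • v) * √(F (l + t • v))) 0 0 := hv 0
    have v1 : HasDerivAt
      (fun t : ℝ => sincTau (l + t • v) / 2 * rotU (l + t • v) - b.1) 0 0 := hv 1
    have v2 : HasDerivAt
      (fun t : ℝ => sincTau (l + t • v) / 2 * rotV (l + t • v) - b.2) 0 0 := hv 2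
    have dU := hasDerivAt_rotU_line l v
    have dV := hasDerivAt_rotV_line l v
    have dt := hasDerivAt_tau_line hr v
    have dk := hasDerivAt_sincTau_line hr v
    have hCS := Real.sin_sq_add_cos_sq (l 0 / 2)
    have hl0 : l + (0 : ℝ) • v = l := by simp
    have dF : HasDerivAt (fun t : ℝ => √(F (l + t • v))) _ 0 :=
      (DifferentiableAt.comp (0 : ℝ) (f := fun t : ℝ => l + t • v) (g := fun x => √(F x))
        (by rw [hl0]; exact ((hFsm l hlU₁).sqrt (hFl.symm ▸ hσh.ne')).differentiableAt (by simp))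
        (hasDerivAt_line l v).differentiableAt).hasDerivAt
    have ds : HasDerivAt (fun t : ℝ => s (l + t • v)) _ 0 :=
      HasDerivAt.comp (0 : ℝ) (h₂ := Real.arcsin)
        (Real.hasDerivAt_arcsin (by simp [← hτdef]) (by simp [← hτdef]))
        ((dt.sub_const τ₀).div_const δ)
    have e0 := v0.unique (ds.mul dF)
    rw [hl0, hsl, zero_mul, add_zero, hFl, ← hτdef] at e0
    -- As `s` vanishes at `l`, only its derivative contributes to that of `s √F`, so `τ` is
    -- stationary, and with it `sincTau`. Stationarity of `b` then means that of `rotU` and `rotV`,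
    -- hence of `u² + v²`; since `w ≠ 0`, this gives `v 0 = 0`.
    have hrad : l 0 * v 0 - (l 1 * v 1 + l 2 * v 2) = 0 := by
      have h := e0.symm
      simpa [hτ.ne', hδ.ne', (Real.sqrt_pos.2 hσh).ne'] using h
    rw [hrad] at dk
    have e1 := v1.unique (((dk.div_const 2).mul dU).sub_const b.1)
    have e2 := v2.unique (((dk.div_const 2).mul dV).sub_const b.2)
    simp only [hl0, zero_div, mul_zero, zero_mul, zero_add] at e1 e2
    have f1 := (mul_eq_zero.1 e1.symm).resolve_left (div_ne_zero hk0 two_ne_zero)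
    have f2 := (mul_eq_zero.1 e2.symm).resolve_left (div_ne_zero hk0 two_ne_zero)
    rw [rotV] at f1
    rw [rotU] at f2
    set C := Real.cos (l 0 / 2)
    set S := Real.sin (l 0 / 2)
    have hdot : l 1 * v 1 + l 2 * v 2 = 0 := by
      linear_combination (l 1 * C + l 2 * S) * f1 + (l 2 * C - l 1 * S) * f2 -
        (l 1 * v 1 + l 2 * v 2) * hCS
    have hv0 : v 0 = 0 := by
      rw [hdot, sub_zero] at hrad
      exact (mul_eq_zero.1 hrad).resolve_left hw
    rw [hv0] at f1 f2
    have hv1 : v 1 = 0 := by linear_combination C * f1 - S * f2 - v 1 * hCS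
    have hv2 : v 2 = 0 := by linear_combination S * f1 + C * f2 - v 2 * hCS
    ext k
    fin_cases k
    · exact hv0
    · exact hv1
    · exact hv2
  · rw [contDiff_iff_contDiffAt]
    intro y
    have hy : ContDiffAt ℝ ∞ (fun y : Fin 4 → ℝ => (y 2, y 3)) y := by fun_prop
    have hR : ContDiffAt ℝ ∞ (fun y : Fin 4 → ℝ => endRe ε (y 2, y 3) τ₀) y :=
      contDiffAt_endRe hy contDiffAt_const hs₀
    have hI : ContDiffAt ℝ ∞ (fun y : Fin 4 → ℝ => endIm ε (y 2, y 3) τ₀) y :=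
      contDiffAt_endIm hy contDiffAt_const hs₀
    refine contDiffAt_pi.2 fun k => ?_
    fin_cases k <;> simp <;> fun_prop
  · rw [hx₀]
    ext k
    fin_cases k <;> simp
    right
    ring
  · intro y a hy hya hg hq
    rw [hx₀] at hy
    have hyd := hya.differentiableAt
    rw [hasDerivAt_pi] at hya hg
    have g1 := (hg 1).unique ((hya 2).sub_const b.1)
    have g2 := (hg 2).unique ((hya 3).sub_const b.2)
    have ha2 : a 2 = 0 := g1.symm
    have ha3 : a 3 = 0 := g2.symm
    have hy2 : y 0 2 = b.1 := by simp [hy]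
    have hy3 : y 0 3 = b.2 := by simp [hy]
    have hp : HasDerivAt (fun t => (y t 2, y t 3)) ((0 : ℝ), (0 : ℝ)) 0 := by
      have := (hya 2).prodMk (hya 3)
      rwa [ha2, ha3] at this
    -- The turning point depends on `b` alone and is therefore stationary. The area condition and
    -- tangency to the quadric remain, a linear system for `a 0`, `a 1` of determinant `1 + |b|²` up
    -- to sign.
    have hfix : ∀ G : ℝ × ℝ → ℝ, ContDiffAt ℝ ∞ G (y 0 2, y 0 3) →
        HasDerivAt (fun t => G (y t 2, y t 3)) 0 0 := by
      intro G hG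
      refine ((hG.differentiableAt (by simp)).hasFDerivAt.comp_hasDerivAt (0 : ℝ) hp).congr_deriv ?_
      exact map_zero _
    have hR := hfix (fun b => endRe ε b τ₀) (contDiffAt_endRe contDiffAt_id contDiffAt_const hs₀)
    have hI := hfix (fun b => endIm ε b τ₀) (contDiffAt_endIm contDiffAt_id contDiffAt_const hs₀)
    have g0 := (hg 0).unique ((((hya 1).mul hR).sub ((hya 0).mul hI)).const_mul σ)
    have hσ0 : σ ≠ 0 := by
      rintro rfl
      norm_num at hσ
    have hsq := endRe_sq_add_endIm_sq hε b hs₀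
    have hpos : 1 + (b.1 ^ 2 + b.2 ^ 2) ≠ 0 := by positivity
    simp only [hy2, hy3, Prod.mk.eta, mul_zero, add_zero] at g0
    have g0' := (mul_eq_zero.1 g0.symm).resolve_left hσ0
    simp [hy, ha2, ha3] at hq
    have h1 : (1 + (b.1 ^ 2 + b.2 ^ 2)) * a 1 = 0 := by
      linear_combination endRe ε b τ₀ * g0' + endIm ε b τ₀ * hq - a 1 * hsq
    have h0 : (1 + (b.1 ^ 2 + b.2 ^ 2)) * a 0 = 0 := by
      linear_combination -endIm ε b τ₀ * g0' + endRe ε b τ₀ * hq - a 0 * hsq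
    ext k
    fin_cases k
    · exact (mul_eq_zero.1 h0).resolve_left hpos
    · exact (mul_eq_zero.1 h1).resolve_left hpos
    · exact ha2
    · exact ha3
  · rintro x ⟨⟨hx, hFx⟩, hxw⟩ hrx
    have hlt := abs_lt.1 (hU₁δ x hx)
    have hsx : τ₀ + δ * Real.sin (s x) = tau x := by
      rw [Real.sin_arcsin]
      · field_simp
        ring
      · rw [le_div_iff₀ hδ]
        linarith
      · rw [div_le_iff₀ hδ]
        linarith
    rw [lorentz_flowMatrix_eq_end hε hrx hxw (hδs _ (hU₁δ x hx).le)]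
    have hTx := hT (endB x) (s x)
    rw [hsx] at hTx
    ext k
    fin_cases k
    · simp only [Fin.zero_eta, Matrix.cons_val, Prod.mk.eta, mul_pow]
      rw [Real.sq_sqrt (le_of_lt hFx), hTx]
      ring
    · simp
    · simp

end SL2Exp

theorem mainTheorem9 (q : SL2Exp.SL2) :
    (∀ l ∈ SL2Exp.C0, l ∈ SL2Exp.Conj q ∧
      SL2Exp.ExpEquivalentNear q l (fun p => ![p 0 ^ 2, p 1, p 2])) ∧
    (∀ l ∈ SL2Exp.C1, l ∈ SL2Exp.Conj q ∧
      SL2Exp.ExpEquivalentNear q l (fun p => ![p 0 * p 2, p 1, p 2])) := by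
  refine ⟨fun l hl => ?_, fun l hl => ?_⟩
  · have h := SL2Exp.expEquivalentNear_of_mem_C0 q hl
    -- Along the first axis the fold is `(t², 0, 0)` and the other model is identically zero, so
    -- both differentials at the origin kill this vector.
    refine ⟨h.mem_conj (differentiableAt_pi.2 fun k => ?_) (v := Pi.single 0 1) (by simp)
      (hasDerivAt_pi.2 fun k => ?_), h⟩
    · fin_cases k <;> simp <;> fun_prop
    · fin_cases k
      · simpa using hasDerivAt_pow 2 (0 : ℝ)
      · simpa using hasDerivAt_const (0 : ℝ) (0 : ℝ)
      · simpa using hasDerivAt_const (0 : ℝ) (0 : ℝ)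
  · have h := SL2Exp.expEquivalentNear_of_mem_C1 q hl
    refine ⟨h.mem_conj (differentiableAt_pi.2 fun k => ?_) (v := Pi.single 0 1) (by simp)
      (hasDerivAt_pi.2 fun k => ?_), h⟩
    · fin_cases k <;> simp <;> fun_prop
    · fin_cases k <;> simpa using hasDerivAt_const (0 : ℝ) (0 : ℝ)
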